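/- Let $p$ be an odd prime, let $L/K$ be a separable field extension of degree $2p$ with normal closure $\widetilde L/K$, and let $G=\mathrm{Gal}(\widetilde L/K)$. A Hopf Galois structure on $L/K$ is a pair $(H,\mu)$ of a finite cocommutative $K$-Hopf algebra $H$ and a $K$-linear map $\mu:H\to\mathrm{End}_K(L)$ making $L$ a left $H$-module algebra such that the induced map $L\otimes_K H\to\mathrm{End}_K(L)$ is bijective. It is of cyclic type if $\widetilde L\otimes_K H\cong\widetilde L[C_{2p}]$ as $\widetilde L$-Hopf algebras, where $C_n$ denotes the cyclic group of order $n$ (equivalently, the regular permutation group attached to it by the Greither-Pareigis correspondence is cyclic). Hopf Galois structures are counted up to isomorphism, that is, up to isomorphisms of $K$-Hopf algebras compatible with the actions on $L$. Then $L/K$ has a Hopf Galois structure of cyclic type if and only if $G$ is isomorphic to (i) a semidirect product $C_{2p}\rtimes C_m$ for some $m$ dividing $p-1$, with $C_m$ acting faithfully on $C_{2p}$, or (ii) a semidirect product $C_p\rtimes C_m$ for some even $m$ dividing $p-1$, with $C_m$ acting faithfully on $C_p$. If $L/K$ has a Hopf Galois structure of cyclic type, then the number of such structures is $p$ if $G$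 is isomorphic to the dihedral group $D_{2p}$ of order $2p$, and $1$ otherwise. -/

import Mathlib

open scoped TensorProduct

universe u v w

/-- A Hopf Galois structure on a field extension `L / K`: a pair `(H, μ)` of a finite cocommutative
`K`-Hopf algebra `H` and a Hopf action `μ : H → End_K(L)`, that is, `μ` makes `L` a left `H`-module
algebra and the induced map `L ⊗ H → End_K(L)` is bijective.  (As `H` is finite over `K`, nothing is
lost by taking it in the universe of `K`.) -/
structure HopfGaloisStructure (K : Type u) (L : Type v) [Field K] [Field L] [Algebra K L] where
  H : Type u
  [ring : Ring H]
  [hopf : HopfAlgebra K H]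
  [finite : Module.Finite K H]
  [cocomm : Coalgebra.IsCocomm K H]
  /-- The action; being an algebra homomorphism, it makes `L` a left `H`-module. -/
  μ : H →ₐ[K] Module.End K L
  /-- `h · 1 = ε(h) 1`. -/
  act_one : ∀ h : H, μ h 1 = algebraMap K L (Coalgebra.counit h)
  /-- `h · (x y) = ∑ (h₁ · x) (h₂ · y)`, where `Δ h = ∑ h₁ ⊗ h₂`. -/
  act_mul : ∀ (h : H) (x y : L), μ h (x * y) =
    LinearMap.mul' K L
      (TensorProduct.map (μ.toLinearMap.flip x) (μ.toLinearMap.flip y) (Coalgebra.comul h))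
  /-- The map `L ⊗ H → End_K(L)` sending `x ⊗ h` to `y ↦ x (h · y)` is bijective. -/
  galois : Function.Bijective
    (TensorProduct.lift ((LinearMap.mul K (Module.End K L)).compl₁₂
      (Algebra.lmul K L).toLinearMap μ.toLinearMap) : L ⊗[K] H →ₗ[K] Module.End K L)

namespace HopfGaloisStructure

attribute [instance] ring hopf finite cocomm

variable {K : Type u} {L : Type v} [Field K] [Field L] [Algebra K L]

/-- Two Hopf Galois structures are isomorphic if there is an isomorphism of `K`-Hopf algebras
compatible with the actions on `L`.  (A bialgebra isomorphism between Hopf algebras automatically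
respects the antipodes.) -/
def Iso (S T : HopfGaloisStructure K L) : Prop :=
  ∃ f : S.H ≃ₐc[K] T.H, ∀ h : S.H, T.μ (f h) = S.μ h

/-- Isomorphism of Hopf Galois structures, as an equivalence relation. -/
instance isoSetoid (K : Type u) (L : Type v) [Field K] [Field L] [Algebra K L] :
    Setoid (HopfGaloisStructure K L) where
  r := Iso
  iseqv :=
    { refl := fun S => ⟨BialgEquiv.refl K S.H, fun _ => rfl⟩
      symm := by
        rintro S T ⟨f, hf⟩
        refine ⟨f.symm, fun h => ?_⟩
        rw [← hf (f.symm h)]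
        exact congrArg T.μ (f.apply_symm_apply h)
      trans := by
        rintro S T U ⟨f, hf⟩ ⟨g, hg⟩
        exact ⟨f.trans g, fun h => (hg (f h)).trans (hf h)⟩ }

/-- Let `M` be the normal closure of `L / K`.  The Hopf Galois structure `(H, μ)` has type `N` if
`H` becomes the group algebra of `N` over `M`, that is, `M ⊗ H ≅ M[N]` as `M`-Hopf algebras.  As
`N` is the group of group-like elements of `M[N]`, this determines `N` up to isomorphism; it is the
group attached to `(H, μ)` by the Greither-Pareigis correspondence, under which `H = M[N]^G` with
`G = Gal(M / K)`, so that `M ⊗ H = M[N]` by Galois descent. -/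
def IsOfType (S : HopfGaloisStructure K L) (M : Type w) [Field M] [Algebra K M]
    (N : Type*) [Group N] : Prop :=
  Nonempty ((M ⊗[K] S.H) ≃ₐc[M] MonoidAlgebra M N)

/-- The set of isomorphism classes of Hopf Galois structures of type `N` on `L / K`, where `M` is
the normal closure of `L / K`. -/
def classesOfType (K : Type u) (L : Type v) [Field K] [Field L] [Algebra K L]
    (M : Type w) [Field M] [Algebra K M] (N : Type*) [Group N] :
    Set (Quotient (isoSetoid K L)) :=
  {c | ∃ S : HopfGaloisStructure K L, S.IsOfType M N ∧ Quotient.mk (isoSetoid K L) S = c}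

end HopfGaloisStructure

/-- The cyclic group of order `n` (for `0 < n`), written multiplicatively. -/
abbrev Cyc (n : ℕ) : Type := Multiplicative (ZMod n)

/-- `G` is isomorphic to the semidirect product `C_n ⋊ C_m` of cyclic groups of order `n` and `m`,
where `C_m` acts faithfully on `C_n`. -/
def IsCyclicSemidirect (G : Type*) [Group G] (n m : ℕ) : Prop :=
  ∃ φ : Cyc m →* MulAut (Cyc n), Function.Injective φ ∧ Nonempty (G ≃* Cyc n ⋊[φ] Cyc m)

/-! Write `M` for the normal closure, `G` for its Galois group, `X` for the set of `K`-embeddings of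
`L` in `M`, and `C` for an abelian group of order `[L : K]`. `G` acts faithfully and transitively on
`X`. The proof has two halves.

The first is the Greither-Pareigis correspondence for abelian types: Hopf Galois structures of type
`C`, up to isomorphism, match the regular subgroups of `Perm X` that are isomorphic to `C` and
normalised by `G`. A group-like element of `M ⊗ H` turns each embedding into another one, so an
isomorphism `M ⊗ H ≅ M[C]` makes `C` act on `X` (`exists_isRegNormalized`). Conversely, conjugation
by `G` twists the Galois action on `M[C]`; the fixed points form a Hopf algebra acting on `L`
(`exists_hopfGaloisStructure_of_isForm`). Both the isomorphism class and the subgroup are recovered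
from one `M`-subspace of the functions from `X` to `Hom_K(L, M)`, so the counts agree
(`ncard_classesOfType`).

The second is about permutation groups of degree `2p`. Let `θ : G → Aut C` be conjugation on a
normalised regular `C` of order `2p`. Its kernel lies in `C`, which is its own centraliser, and its
image has order dividing `p - 1`; transitivity then forces the kernel to have order `p` or `2p`
(`natCard_ker`). A complement (Schur-Zassenhaus, or a point stabiliser) gives the two families.
Conversely, a normal cyclic subgroup of order `2p` is itself regular, while for `C_p ⋊ C_m` one
adjoins to `C_p` a fixed-point-free involution commuting with `G`, namely right translation by a
suitable square root of a generator of a point stabiliser.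

For the count, the elements of order `p` in `C` come from `G` and are common to all solutions, and
the involution of `C` commutes with `G`, hence is determined by the image of one point. If a
nontrivial element of `G` fixes a point, that image is forced. Otherwise `G` is regular: either it
is itself the only solution, or it is dihedral and its `p` reflections give `p` solutions. -/

set_option linter.unusedSectionVars false

/-! ### Embeddings of a separable extension into its normal closure -/

section Embeddings

variable (K : Type u) (L : Type v) (M : Type w) [Field K] [Field L] [Field M]
  [Algebra K L] [Algebra K M]

/-- The action of the Galois group on embeddings, by composition. -/
def embPerm : (M ≃ₐ[K] M) →* Equiv.Perm (L →ₐ[K] M) where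
  toFun σ :=
    { toFun := fun x => (σ : M →ₐ[K] M).comp x
      invFun := fun x => (σ.symm : M →ₐ[K] M).comp x
      left_inv := fun x => by ext; simp
      right_inv := fun x => by ext; simp }
  map_one' := by ext; simp
  map_mul' σ τ := by ext; simp

variable {K L M}

@[simp] theorem embPerm_apply (σ : M ≃ₐ[K] M) (x : L →ₐ[K] M) (l : L) :
    embPerm K L M σ x l = σ (x l) := rfl

variable (K L M) [Algebra.IsSeparable K L] [IsNormalClosure K L M] [FiniteDimensional K L]

theorem iSup_fieldRange_eq_top : (⨆ f : L →ₐ[K] M, f.fieldRange) = ⊤ :=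
  (Algebra.IsAlgebraic.isNormalClosure_iff.mp inferInstance).2

theorem card_embeddings : Nat.card (L →ₐ[K] M) = Module.finrank K L := by
  rw [Nat.card_eq_fintype_card,
    AlgHom.card_of_splits K L M (fun x => IsNormalClosure.splits x)]

theorem nonempty_embeddings : Nonempty (L →ₐ[K] M) := by
  have h : 0 < Nat.card (L →ₐ[K] M) := by
    rw [card_embeddings]
    exact Module.finrank_pos
  exact (Nat.card_pos_iff.mp h).1

/-- An automorphism that fixes every embedding fixes the images of all embeddings pointwise, and
these generate `M`. -/
theorem embPerm_injective : Function.Injective (embPerm K L M) := by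
  rw [injective_iff_map_eq_one]
  intro σ hσ
  have h : (⨆ f : L →ₐ[K] M, f.fieldRange) ≤
      IntermediateField.fixedField (Subgroup.zpowers σ) := by
    refine iSup_le fun f => ?_
    rintro _ ⟨l, rfl⟩
    rw [IntermediateField.mem_fixedField_iff]
    have hfix : ∀ n : ℤ, (embPerm K L M (σ ^ n)) f = f := by
      intro n; rw [map_zpow, hσ]; simp
    rintro _ ⟨n, rfl⟩
    exact DFunLike.congr_fun (hfix n) l
  rw [iSup_fieldRange_eq_top K L M] at h
  ext m
  exact (IntermediateField.mem_fixedField_iff _ _).mp (h (IntermediateField.mem_top (x := m)))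
    σ (Subgroup.mem_zpowers σ)

theorem embPerm_transitive (x y : L →ₐ[K] M) : ∃ σ, embPerm K L M σ x = y := by
  have hn : Normal K M := IsNormalClosure.normal (K := L)
  -- Viewing `M` as an extension of `L` through `x`, normality extends `y` from `L` to all of `M`.
  let _ : Algebra L M := x.toRingHom.toAlgebra
  have : IsScalarTower K L M := IsScalarTower.of_algebraMap_eq fun k => (x.commutes k).symm
  refine ⟨AlgEquiv.ofBijective (AlgHom.liftNormal y M)
    (Algebra.IsAlgebraic.algHom_bijective _), ?_⟩
  ext l
  exact AlgHom.liftNormal_commutes y M l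

end Embeddings

theorem finiteDimensional_of_isNormalClosure (K : Type u) (L : Type v) (M : Type w) [Field K] [Field L]
    [Field M] [Algebra K L] [Algebra K M] [Algebra.IsSeparable K L] [IsNormalClosure K L M]
    [FiniteDimensional K L] :
    FiniteDimensional K M := by
  have h : FiniteDimensional K (IntermediateField.normalClosure K L M) := inferInstance
  have h2 : IntermediateField.normalClosure K L M = ⊤ := iSup_fieldRange_eq_top K L M
  rw [h2] at h
  exact LinearEquiv.finiteDimensional
    (IntermediateField.topEquiv (F := K) (E := M)).toLinearEquiv

theorem isGalois_of_isNormalClosure (K : Type u) (L : Type v) (M : Type w) [Field K] [Field L]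
    [Field M] [Algebra K L] [Algebra K M] [Algebra.IsSeparable K L] [IsNormalClosure K L M]
    [FiniteDimensional K L] :
    IsGalois K M := by
  have hn : Normal K M := IsNormalClosure.normal (K := L)
  have hs : ∀ f : L →ₐ[K] M, Algebra.IsSeparable K f.fieldRange := fun f =>
    Algebra.IsSeparable.of_algHom K L
      (f := (AlgEquiv.ofInjectiveField f).symm.toAlgHom)
  have h : Algebra.IsSeparable K (⨆ f : L →ₐ[K] M, f.fieldRange : IntermediateField K M) :=
    IntermediateField.isSeparable_iSup K M
  rw [iSup_fieldRange_eq_top K L M] at h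
  have : Algebra.IsSeparable K M := Algebra.IsSeparable.of_algHom K _
    (f := (IntermediateField.topEquiv (F := K) (E := M)).symm.toAlgHom)
  exact ⟨⟩

/-! ### Galois descent for equivariant functions on finite sets -/

section Descent

variable {K : Type u} {M : Type w} [Field K] [Field M] [Algebra K M]

/-- The functions `f : Y → M` with `f (σ y) = σ (f y)`. -/
def equivariantFun {Y : Type*} (ψ : (M ≃ₐ[K] M) →* Equiv.Perm Y) : Submodule K (Y → M) where
  carrier := {f | ∀ σ y, f (ψ σ y) = σ (f y)}
  add_mem' hf hg σ y := by simp [hf σ y, hg σ y]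
  zero_mem' := by simp
  smul_mem' k f hf σ y := by simp [hf σ y]

variable [FiniteDimensional K M] [IsGalois K M] {Y : Type*}

/-- Equivariance lets every `σ` be applied to the coefficients of a relation. Multiplying the
resulting relations by `σ m` and summing over `σ` gives relations over `K` with coefficients `Tr (m
a j)`; these vanish for every `m`, and the trace form is nondegenerate. -/
theorem LinearIndependent.of_equivariantFun {ψ : (M ≃ₐ[K] M) →* Equiv.Perm Y} {ι : Type*}
    {v : ι → Y → M} (hv : LinearIndependent K v) (hmem : ∀ i, v i ∈ equivariantFun ψ) :
    LinearIndependent M v := by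
  classical
  rw [linearIndependent_iff'] at hv ⊢
  intro s a ha i hi
  have hσ : ∀ σ : M ≃ₐ[K] M, ∑ j ∈ s, σ (a j) • v j = 0 := by
    intro σ
    ext y
    have h := congrArg σ (congrFun ha ((ψ σ)⁻¹ y))
    simp only [Finset.sum_apply, Pi.smul_apply, smul_eq_mul, map_sum, map_mul, Pi.zero_apply,
      map_zero] at h ⊢
    rw [← h]
    refine Finset.sum_congr rfl fun j _ => ?_
    rw [← hmem j σ, ← Equiv.Perm.mul_apply, mul_inv_cancel, Equiv.Perm.one_apply]
  have htr : ∀ m : M, ∀ j ∈ s, Algebra.trace K M (m * a j) = 0 := by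
    intro m
    refine hv s (fun j => Algebra.trace K M (m * a j)) ?_
    have : ∑ σ : M ≃ₐ[K] M, σ m • ∑ j ∈ s, σ (a j) • v j = 0 := by simp [hσ]
    rw [← this]
    simp only [Finset.smul_sum]
    rw [Finset.sum_comm]
    refine Finset.sum_congr rfl fun j _ => ?_
    ext y
    rw [Pi.smul_apply, Algebra.smul_def, trace_eq_sum_automorphisms]
    simp only [Pi.smul_apply, Finset.sum_apply, Finset.sum_mul, map_mul, smul_eq_mul, mul_assoc]
  refine (traceForm_nondegenerate K M).1 (a i) fun m => ?_
  rw [Algebra.traceForm_apply, mul_comm]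
  exact htr m i hi

/-- Suppose a functional `f` kills all equivariant functions. On the orbit sums `∑ σ m • δ_{σ y₀}`
this is a linear relation between the automorphisms `σ`, so Dedekind independence makes its
coefficient at `σ = 1`, the value of `f` at `δ_{y₀}`, zero. -/
theorem span_equivariantFun [Finite Y] (ψ : (M ≃ₐ[K] M) →* Equiv.Perm Y) :
    Submodule.span M (equivariantFun ψ : Set (Y → M)) = ⊤ := by
  classical
  have := Fintype.ofFinite Y
  by_contra hne
  obtain ⟨f, hf0, hf⟩ := Submodule.exists_le_ker_of_lt_top _ (lt_top_iff_ne_top.mpr hne)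
  apply hf0
  refine (Pi.basisFun M Y).ext fun y₀ => ?_
  have key : ∀ m : M, ∑ σ : M ≃ₐ[K] M, f (Pi.single (ψ σ y₀) 1) * σ m = 0 := by
    intro m
    have hmem : (∑ σ : M ≃ₐ[K] M, σ m • (Pi.single (ψ σ y₀) 1 : Y → M)) ∈ equivariantFun ψ := by
      intro τ y
      simp only [Finset.sum_apply, Pi.smul_apply, smul_eq_mul, map_sum, map_mul]
      refine (Fintype.sum_equiv (Equiv.mulLeft τ) _ _ fun σ => ?_).symm
      simp only [Equiv.coe_mulLeft, AlgEquiv.mul_apply, map_mul, Equiv.Perm.mul_apply,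
        Pi.single_apply, (ψ τ).injective.eq_iff]
      split_ifs <;> simp
    have h := hf (Submodule.subset_span hmem)
    rw [LinearMap.mem_ker, map_sum] at h
    rw [← h]
    refine Finset.sum_congr rfl fun σ _ => ?_
    rw [map_smul, smul_eq_mul, mul_comm]
  have hind := linearIndependent_iff'.mp ((linearIndependent_monoidHom M M).comp
    (fun σ : M ≃ₐ[K] M => (σ : M →* M)) (fun σ τ h => by
      ext m; exact DFunLike.congr_fun h m)) Finset.univ
    (fun σ => f (Pi.single (ψ σ y₀) 1)) (by
      ext m
      simpa using key m) 1 (Finset.mem_univ _)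
  simpa using hind

theorem finrank_equivariantFun [Finite Y] (ψ : (M ≃ₐ[K] M) →* Equiv.Perm Y) :
    Module.finrank K (equivariantFun ψ) = Nat.card Y := by
  classical
  have := Fintype.ofFinite Y
  let b := Module.Free.chooseBasis K (equivariantFun ψ)
  have hli : LinearIndependent M fun i => (b i : Y → M) :=
    LinearIndependent.of_equivariantFun (ψ := ψ)
      (b.linearIndependent.map' (equivariantFun ψ).subtype (Submodule.ker_subtype _))
      fun i => (b i).2
  have hsp : ⊤ ≤ Submodule.span M (Set.range fun i => (b i : Y → M)) := by
    rw [← span_equivariantFun ψ, Submodule.span_le]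
    intro f hf
    have h := congrArg (equivariantFun ψ).subtype (b.linearCombination_repr ⟨f, hf⟩)
    rw [Finsupp.linearCombination_apply, map_finsuppSum] at h
    simp only [Submodule.subtype_apply, map_smul] at h
    rw [← h]
    refine Submodule.sum_mem _ fun i _ => ?_
    change (b.repr ⟨f, hf⟩ i) • (b i : Y → M) ∈ _
    rw [← algebraMap_smul M]
    exact Submodule.smul_mem _ _ (Submodule.subset_span ⟨i, rfl⟩)
  let b' := Module.Basis.mk hli hsp
  rw [Module.finrank_eq_nat_card_basis b, ← Module.finrank_eq_nat_card_basis b',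
    Module.finrank_fintype_fun_eq_card, Nat.card_eq_fintype_card]

end Descent

/-! ### Forms of group algebras -/

section Forms

open MonoidAlgebra

variable {K : Type u} {M : Type w} [Field K] [Field M] [Algebra K M]

/-- The coefficients of an element of a monoid algebra, as a function. -/
def coeffFun (K M Y : Type*) [Field K] [Field M] [Algebra K M] :
    MonoidAlgebra M Y →ₗ[M] (Y → M) where
  toFun ξ y := ξ.coeff y
  map_add' ξ η := by ext; simp
  map_smul' m ξ := by ext; simp

/-- The map sends some `K`-basis to an `M`-linearly independent family. -/
def PreservesIndep {A V : Type*} [AddCommGroup A] [Module K A] [AddCommGroup V] [Module K V]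
    [Module M V] (f : A →ₗ[K] V) : Prop :=
  ∃ (n : ℕ) (b : Module.Basis (Fin n) K A), LinearIndependent M fun i => f (b i)

theorem PreservesIndep.injective {A V : Type*} [AddCommGroup A] [Module K A] [AddCommGroup V]
    [Module K V] [Module M V] [IsScalarTower K M V] {f : A →ₗ[K] V}
    (h : PreservesIndep (M := M) f) : Function.Injective f := by
  obtain ⟨n, b, hb⟩ := h
  have hK : LinearIndependent K (f ∘ b) := hb.restrict_scalars' K
  rw [injective_iff_map_eq_zero]
  intro x hx
  rw [← b.linearCombination_repr x, Finsupp.apply_linearCombination] at hx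
  exact b.repr.map_eq_zero_iff.mp (linearIndependent_iff.mp hK _ hx)

variable {Y Z : Type*} [CommMonoid Y] [CommMonoid Z] {A B : Type*} [CommRing A] [CommRing B]
  [Algebra K A] [Algebra K B]

/-- The map `A ⊗ B → M[Y × Z]` induced by `A → M[Y]` and `B → M[Z]`. -/
noncomputable def formTensor (f : A →ₐ[K] MonoidAlgebra M Y) (g : B →ₐ[K] MonoidAlgebra M Z) :
    A ⊗[K] B →ₐ[K] MonoidAlgebra M (Y × Z) :=
  Algebra.TensorProduct.lift ((mapDomainAlgHom K M (MonoidHom.inl Y Z)).comp f)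
    ((mapDomainAlgHom K M (MonoidHom.inr Y Z)).comp g) fun _ _ => Commute.all _ _

theorem formTensor_tmul (f : A →ₐ[K] MonoidAlgebra M Y) (g : B →ₐ[K] MonoidAlgebra M Z)
    (a : A) (b : B) : formTensor f g (a ⊗ₜ b) =
      mapDomainAlgHom K M (MonoidHom.inl Y Z) (f a) *
        mapDomainAlgHom K M (MonoidHom.inr Y Z) (g b) := by
  simp [formTensor]

@[simp] theorem mapDomainAlgHom_single (φ : Y →* Z) (y : Y) (m : M) :
    mapDomainAlgHom K M φ (single y m) = single (φ y) m := by
  simp [mapDomainAlgHom]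

theorem mapDomainAlgHom_apply_comp {W : Type*} [CommMonoid W] (φ : Y →* Z) (χ : Z →* W)
    (ξ : MonoidAlgebra M Y) :
    mapDomainAlgHom K M χ (mapDomainAlgHom K M φ ξ) = mapDomainAlgHom K M (χ.comp φ) ξ := by
  simp

theorem coeff_inl_mul_inr (ξ : MonoidAlgebra M Y) (η : MonoidAlgebra M Z) (y : Y) (z : Z) :
    (mapDomainAlgHom K M (MonoidHom.inl Y Z) ξ *
      mapDomainAlgHom K M (MonoidHom.inr Y Z) η).coeff (y, z) = ξ.coeff y * η.coeff z := by
  classical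
  induction ξ using MonoidAlgebra.induction_linear with
  | zero => simp
  | add ξ ξ' h h' => simp only [map_add, add_mul, coeff_add, Finsupp.add_apply, h, h']
  | single y' m =>
    induction η using MonoidAlgebra.induction_linear with
    | zero => simp
    | add η η' h h' => simp only [map_add, mul_add, coeff_add, Finsupp.add_apply, h, h']
    | single z' m' =>
      simp only [mapDomainAlgHom_single, single_mul_single, MonoidHom.inl_apply,
        MonoidHom.inr_apply, Prod.mk_mul_mk, mul_one, one_mul, coeff_single, Finsupp.single_apply, Prod.mk.injEq]
      by_cases h1 : y' = y <;> by_cases h2 : z' = z <;> simp [h1, h2]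

@[simp] theorem coeff_formTensor_tmul (f : A →ₐ[K] MonoidAlgebra M Y)
    (g : B →ₐ[K] MonoidAlgebra M Z) (a : A) (b : B) (y : Y) (z : Z) :
    (formTensor f g (a ⊗ₜ b)).coeff (y, z) = (f a).coeff y * (g b).coeff z := by
  rw [formTensor_tmul, coeff_inl_mul_inr]

/-- Coefficients at `(y, z)` are products, so a relation read at fixed `z` is a relation between the
`f (b i)`, and what remains is a relation between the `g (c j)`. It embeds tensor powers of a form
in group algebras, where the Hopf axioms can be checked on group elements. -/
theorem PreservesIndep.formTensor {f : A →ₐ[K] MonoidAlgebra M Y}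
    {g : B →ₐ[K] MonoidAlgebra M Z} (hf : PreservesIndep (M := M) f.toLinearMap)
    (hg : PreservesIndep (M := M) g.toLinearMap) :
    PreservesIndep (M := M) (formTensor f g).toLinearMap := by
  obtain ⟨n, b, hb⟩ := hf
  obtain ⟨k, c, hc⟩ := hg
  refine ⟨n * k, (b.tensorProduct c).reindex finProdFinEquiv, ?_⟩
  rw [← linearIndependent_equiv finProdFinEquiv]
  rw [Fintype.linearIndependent_iff] at hb hc ⊢
  rintro a ha ⟨i, j⟩
  have key : ∀ y z, ∑ i, ∑ j, a (i, j) * ((f (b i)).coeff y * (g (c j)).coeff z) = 0 := by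
    intro y z
    have h := congrArg (fun ξ : MonoidAlgebra M (Y × Z) => ξ.coeff (y, z)) ha
    simp only [Function.comp_apply, Module.Basis.reindex_apply, Equiv.symm_apply_apply,
      Module.Basis.tensorProduct_apply', AlgHom.toLinearMap_apply, coeff_sum, coeff_smul,
      Finsupp.coe_finsetSum, Finset.sum_apply, Finsupp.smul_apply, coeff_formTensor_tmul,
      smul_eq_mul, coeff_zero, Finsupp.coe_zero, Pi.zero_apply, Fintype.sum_prod_type] at h
    exact h
  refine hc (fun j => a (i, j)) ?_ j
  ext z
  have hz := hb (fun i => ∑ j, a (i, j) * (g (c j)).coeff z) (by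
    ext y
    simp only [AlgHom.toLinearMap_apply, coeff_sum, coeff_smul, Finsupp.coe_finsetSum,
      Finset.sum_apply, Finsupp.smul_apply, smul_eq_mul, coeff_zero, Finsupp.coe_zero,
      Pi.zero_apply, Finset.sum_mul]
    rw [← key y z]
    refine Finset.sum_congr rfl fun i _ => Finset.sum_congr rfl fun j _ => by ring) i
  simpa [coeff_sum] using hz

variable {C : Type*} [CommGroup C]

/-- The subalgebra of elements of `M[C]` fixed under the Galois group, which acts on the
coefficients and, through `θ`, on `C`. -/
def fixedSubalgebra (θ : (M ≃ₐ[K] M) →* MulAut C) : Subalgebra K (MonoidAlgebra M C) where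
  carrier := {ξ | ∀ σ : M ≃ₐ[K] M, ∀ c, ξ.coeff (θ σ c) = σ (ξ.coeff c)}
  mul_mem' := by
    classical
    intro ξ η hξ hη σ
    -- Being fixed by `σ` is rephrased as the agreement of two ring homomorphisms at `ζ`, which
    -- passes to products.
    have hσ : ∀ ζ : MonoidAlgebra M C, (∀ c, ζ.coeff (θ σ c) = σ (ζ.coeff c)) ↔
        mapRingHom C (σ : M →+* M) ζ = mapDomainAlgHom K M (θ σ⁻¹ : C →* C) ζ := by
      intro ζ
      have h1 : ∀ c, (mapDomainAlgHom K M (θ σ⁻¹ : C →* C) ζ).coeff c = ζ.coeff (θ σ c) := by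
        intro c
        have : c = θ σ⁻¹ (θ σ c) := by simp
        conv_lhs => rw [this]
        exact Finsupp.mapDomain_apply (θ σ⁻¹).injective _ _
      constructor
      · intro h
        ext c
        rw [h1, h]
        simp
      · intro h c
        rw [← h1, ← h]
        simp
    rw [hσ]
    have h1 := (hσ ξ).mp (hξ σ)
    have h2 := (hσ η).mp (hη σ)
    rw [map_mul, map_mul, h1, h2]
  add_mem' := fun hξ hη σ c => by simp [hξ σ c, hη σ c]
  algebraMap_mem' k σ c := by
    classical
    by_cases h : c = 1
    · subst h; simp
    · have : θ σ c ≠ 1 := by simpa using h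
      simp [h, this]

end Forms

/-! ### Dimension, base change and tensor square of a form of a group algebra. -/

section FormProperties

open MonoidAlgebra

variable {K : Type u} {M : Type w} [Field K] [Field M] [Algebra K M]
  {C : Type*} [CommGroup C] {D : Type*} [CommRing D] [Algebra K D]

/-- `ι` identifies `D` with the fixed points of `M[C]` under the Galois action given by `θ`. -/
structure IsForm (θ : (M ≃ₐ[K] M) →* MulAut C) (f : D →ₐ[K] MonoidAlgebra M C) : Prop where
  injective : Function.Injective f
  range_eq : f.range = fixedSubalgebra θ

namespace IsForm

variable {θ : (M ≃ₐ[K] M) →* MulAut C} {f : D →ₐ[K] MonoidAlgebra M C}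

theorem coeff_apply (h : IsForm θ f) (d : D) (σ : M ≃ₐ[K] M) (c : C) :
    (f d).coeff (θ σ c) = σ ((f d).coeff c) := by
  have : f d ∈ fixedSubalgebra θ := h.range_eq ▸ ⟨d, rfl⟩
  exact this σ c

theorem exists_apply_eq (h : IsForm θ f) {ξ : MonoidAlgebra M C}
    (hξ : ∀ (σ : M ≃ₐ[K] M) (c : C), ξ.coeff (θ σ c) = σ (ξ.coeff c)) : ∃ d, f d = ξ := by
  have : ξ ∈ f.range := h.range_eq ▸ hξ
  exact this

/-- `D` as a space of equivariant functions. -/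
noncomputable def equivEquivariantFun [Finite C] (h : IsForm θ f) :
    D ≃ₗ[K] equivariantFun ((MulAut.toPerm C).comp θ) :=
  LinearEquiv.ofBijective
    (LinearMap.codRestrict (equivariantFun ((MulAut.toPerm C).comp θ))
      ((coeffFun K M C).restrictScalars K ∘ₗ f.toLinearMap)
      fun d σ c => h.coeff_apply d σ c) <| by
    constructor
    · intro d d' hd
      apply h.injective
      ext c
      exact congrFun (congrArg Subtype.val hd) c
    · rintro ⟨φ, hφ⟩
      obtain ⟨d, hd⟩ := h.exists_apply_eq (ξ := ofCoeff (Finsupp.equivFunOnFinite.symm φ)) hφ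
      refine ⟨d, Subtype.ext ?_⟩
      ext c
      change (f d).coeff c = φ c
      rw [hd]
      rfl

/-- The base change of the form `D` of `M[C]` to `M`. -/
noncomputable def baseChangeHom (f : D →ₐ[K] MonoidAlgebra M C) :
    M ⊗[K] D →ₐ[M] MonoidAlgebra M C :=
  Algebra.TensorProduct.lift (Algebra.ofId M _) f fun _ _ => Commute.all _ _

@[simp] theorem baseChangeHom_tmul (m : M) (d : D) : baseChangeHom f (m ⊗ₜ d) = m • f d := by
  simp [baseChangeHom, Algebra.ofId_apply, Algebra.smul_def]

variable [FiniteDimensional K M] [IsGalois K M] [Finite C]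

theorem finite (h : IsForm θ f) : Module.Finite K D :=
  Module.Finite.equiv h.equivEquivariantFun.symm

theorem finrank_eq (h : IsForm θ f) : Module.finrank K D = Nat.card C := by
  rw [h.equivEquivariantFun.finrank_eq, finrank_equivariantFun]

theorem preservesIndep (h : IsForm θ f) : PreservesIndep (M := M) f.toLinearMap := by
  have := h.finite
  let b := Module.finBasis K D
  refine ⟨_, b, ?_⟩
  have h1 : LinearIndependent M fun i => (h.equivEquivariantFun (b i) : C → M) :=
    LinearIndependent.of_equivariantFun (ψ := (MulAut.toPerm C).comp θ)
      ((b.map h.equivEquivariantFun).linearIndependent.map' (Submodule.subtype _)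
        (Submodule.ker_subtype _)) fun i => (h.equivEquivariantFun (b i)).2
  exact LinearIndependent.of_comp (coeffFun K M C) h1

theorem finrank_monoidAlgebra : Module.finrank M (MonoidAlgebra M C) = Nat.card C := by
  have := Fintype.ofFinite C
  rw [(coeffLinearEquiv M : MonoidAlgebra M C ≃ₗ[M] C →₀ M).finrank_eq,
    Module.finrank_finsupp_self, Nat.card_eq_fintype_card]

theorem baseChangeHom_bijective (h : IsForm θ f) : Function.Bijective (baseChangeHom f) := by
  have hfin := h.finite
  obtain ⟨n, b, hb⟩ := h.preservesIndep
  have hinj : Function.Injective (baseChangeHom f).toLinearMap := by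
    rw [injective_iff_map_eq_zero]
    intro x hx
    have hb' : LinearIndependent M ((baseChangeHom f).toLinearMap ∘ (b.baseChange M)) := by
      have e : (baseChangeHom f).toLinearMap ∘ (b.baseChange M) = fun i => f.toLinearMap (b i) := by
        ext1 i
        simp
      rw [e]
      exact hb
    rw [← (b.baseChange M).linearCombination_repr x, Finsupp.apply_linearCombination] at hx
    exact (b.baseChange M).repr.map_eq_zero_iff.mp (linearIndependent_iff.mp hb' _ hx)
  have : Module.Finite M (MonoidAlgebra M C) :=
    Module.Finite.equiv (coeffLinearEquiv M : MonoidAlgebra M C ≃ₗ[M] C →₀ M).symm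
  refine ⟨hinj, (LinearMap.injective_iff_surjective_of_finrank_eq_finrank ?_).mp hinj⟩
  rw [Module.finrank_baseChange, h.finrank_eq, finrank_monoidAlgebra]

theorem formTensor_injective (h : IsForm θ f) : Function.Injective (formTensor f f) :=
  (h.preservesIndep.formTensor h.preservesIndep).injective

/-- The map `D ⊗ (D ⊗ D) → M[C × (C × C)]` induced by `f`. -/
noncomputable def formTensor₃ (f : D →ₐ[K] MonoidAlgebra M C) :
    D ⊗[K] (D ⊗[K] D) →ₐ[K] MonoidAlgebra M (C × (C × C)) :=
  formTensor f (formTensor f f)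

theorem formTensor₃_injective (h : IsForm θ f) : Function.Injective (formTensor₃ f) := by
  have h₂ : PreservesIndep (M := M) (formTensor f f).toLinearMap :=
    PreservesIndep.formTensor (f := f) (g := f) h.preservesIndep h.preservesIndep
  have h₃ : PreservesIndep (M := M) (formTensor₃ f).toLinearMap :=
    PreservesIndep.formTensor (B := D ⊗[K] D) (Z := C × C) (f := f) (g := formTensor f f) h.preservesIndep h₂
  exact h₃.injective

/-- `D ⊗ D` embeds in the equivariant functions on `C × C`, and both spaces have dimension `|C|²`
over `K`. This is what lets the comultiplication descend. -/
theorem exists_formTensor_eq (h : IsForm θ f) {ξ : MonoidAlgebra M (C × C)}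
    (hξ : ∀ (σ : M ≃ₐ[K] M) (c c' : C),
      ξ.coeff (θ σ c, θ σ c') = σ (ξ.coeff (c, c'))) : ∃ t, formTensor f f t = ξ := by
  have hfin := h.finite
  let ψ : (M ≃ₐ[K] M) →* Equiv.Perm (C × C) :=
    { toFun := fun σ => Equiv.prodCongr (θ σ).toEquiv (θ σ).toEquiv
      map_one' := by ext <;> simp
      map_mul' := fun σ τ => by ext <;> simp }
  have hmem : ∀ t, (coeffFun K M (C × C)) (formTensor f f t) ∈ equivariantFun ψ := by
    intro t
    induction t with
    | zero => simp
    | add x y hx hy => rw [map_add, map_add]; exact Submodule.add_mem _ hx hy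
    | tmul a b =>
      rintro σ ⟨c, c'⟩
      change (formTensor f f (a ⊗ₜ b)).coeff (θ σ c, θ σ c') =
        σ ((formTensor f f (a ⊗ₜ b)).coeff (c, c'))
      simp [h.coeff_apply]
  let F : D ⊗[K] D →ₗ[K] equivariantFun ψ := LinearMap.codRestrict _
    ((coeffFun K M (C × C)).restrictScalars K ∘ₗ (formTensor f f).toLinearMap) hmem
  have hF : Function.Injective F := by
    intro t t' ht
    apply h.formTensor_injective
    ext c
    exact congrFun (congrArg Subtype.val ht) c
  have hfr : Module.finrank K (D ⊗[K] D) = Module.finrank K (equivariantFun ψ) := by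
    rw [Module.finrank_tensorProduct, h.finrank_eq, finrank_equivariantFun, Nat.card_prod]
  obtain ⟨t, ht⟩ := (LinearMap.injective_iff_surjective_of_finrank_eq_finrank hfr).mp hF
    ⟨coeffFun K M _ ξ, by rintro σ ⟨c, c'⟩; exact hξ σ c c'⟩
  refine ⟨t, ?_⟩
  ext c
  exact congrFun (congrArg Subtype.val ht) c

end IsForm

end FormProperties

/-! ### The Hopf algebra structure of a form, by descent from the group algebra. -/

section FormHopf

open MonoidAlgebra

variable {K : Type u} {M : Type w} [Field K] [Field M] [Algebra K M]
  {C : Type*} [CommGroup C] {D : Type*} [CommRing D] [Algebra K D]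

namespace IsForm

/-- The diagonal homomorphism `C → C × C`. -/
def diagHom (C : Type*) [CommGroup C] : C →* C × C := (MonoidHom.id C).prod (MonoidHom.id C)

/-- The augmentation of a group algebra, linear over a smaller field. -/
noncomputable def augHom (K M C : Type*) [Field K] [Field M] [Algebra K M] [CommGroup C] :
    MonoidAlgebra M C →ₐ[K] M :=
  (MonoidAlgebra.lift M M C 1).restrictScalars K

@[simp] theorem augHom_single (c : C) (m : M) : augHom K M C (single c m) = m := by
  simp [augHom]

variable [FiniteDimensional K M] [IsGalois K M] [Finite C]

variable {θ : (M ≃ₐ[K] M) →* MulAut C} {f : D →ₐ[K] MonoidAlgebra M C}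

theorem diag_mem_range (h : IsForm θ f) (d : D) :
    mapDomainAlgHom K M (diagHom C) (f d) ∈ (formTensor f f).range := by
  classical
  refine h.exists_formTensor_eq fun σ c c' => ?_
  have key : ∀ (ξ : MonoidAlgebra M C) (c c' : C),
      (mapDomainAlgHom K M (diagHom C) ξ).coeff (c, c') = if c = c' then ξ.coeff c else 0 := by
    intro ξ c c'
    induction ξ using MonoidAlgebra.induction_linear with
    | zero => simp
    | add ξ ξ' h h' =>
      rw [map_add, coeff_add, Finsupp.add_apply, h, h']
      split_ifs <;> simp
    | single y m =>
      rw [mapDomainAlgHom_single]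
      simp only [diagHom, MonoidHom.prod_apply, MonoidHom.id_apply, coeff_single,
        Finsupp.single_apply, Prod.mk.injEq]
      by_cases h1 : y = c <;> by_cases h2 : c = c' <;> by_cases h3 : y = c' <;> simp_all
  rw [key, key, (θ σ).injective.eq_iff, h.coeff_apply]
  split_ifs <;> simp

/-- The comultiplication of a form of `M[C]`. -/
noncomputable def comulHom (h : IsForm θ f) : D →ₐ[K] D ⊗[K] D :=
  (AlgEquiv.ofInjective (formTensor f f) h.formTensor_injective).symm.toAlgHom.comp
    (((mapDomainAlgHom K M (diagHom C)).comp f).codRestrict _ h.diag_mem_range)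

theorem formTensor_comulHom (h : IsForm θ f) (d : D) :
    formTensor f f (h.comulHom d) = mapDomainAlgHom K M (diagHom C) (f d) :=
  congrArg Subtype.val ((AlgEquiv.ofInjective (formTensor f f)
    h.formTensor_injective).apply_symm_apply ⟨_, h.diag_mem_range d⟩)

theorem augHom_eq_sum [Fintype C] (ξ : MonoidAlgebra M C) :
    augHom K M C ξ = ∑ c, ξ.coeff c := by
  classical
  induction ξ using MonoidAlgebra.induction_linear with
  | zero => simp
  | add ξ ξ' h h' => rw [map_add, h, h', ← Finset.sum_add_distrib]; simp
  | single y m => simp [Finsupp.single_apply]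

theorem augHom_mem_bot (h : IsForm θ f) (d : D) :
    augHom K M C (f d) ∈ (⊥ : Subalgebra K M) := by
  have := Fintype.ofFinite C
  have hm : augHom K M C (f d) ∈ (⊥ : IntermediateField K M) := by
    rw [IsGalois.mem_bot_iff_fixed]
    intro σ
    rw [augHom_eq_sum, map_sum]
    refine Fintype.sum_equiv (θ σ).toEquiv _ _ fun c => ?_
    exact (h.coeff_apply d σ c).symm
  obtain ⟨k, hk⟩ := hm
  exact ⟨k, hk⟩

/-- The counit of a form of `M[C]`. -/
noncomputable def counitHom (h : IsForm θ f) : D →ₐ[K] K :=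
  (Algebra.botEquiv K M).toAlgHom.comp
    (((augHom K M C).comp f).codRestrict ⊥ h.augHom_mem_bot)

theorem algebraMap_counitHom (h : IsForm θ f) (d : D) :
    algebraMap K M (h.counitHom d) = augHom K M C (f d) :=
  congrArg Subtype.val ((Algebra.botEquiv K M).symm_apply_apply ⟨_, h.augHom_mem_bot d⟩)

theorem inv_mem_range (h : IsForm θ f) (d : D) :
    mapDomainAlgHom K M (MulEquiv.inv C).toMonoidHom (f d) ∈ f.range := by
  refine h.exists_apply_eq fun σ c => ?_
  have key : ∀ (ξ : MonoidAlgebra M C) (c : C),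
      (mapDomainAlgHom K M (MulEquiv.inv C).toMonoidHom ξ).coeff c = ξ.coeff c⁻¹ := by
    intro ξ c
    conv_lhs => rw [← inv_inv c]
    exact Finsupp.mapDomain_apply (MulEquiv.inv C).injective _ _
  rw [key, key, ← map_inv, h.coeff_apply]

/-- The antipode of a form of `M[C]`. -/
noncomputable def antipodeHom (h : IsForm θ f) : D →ₐ[K] D :=
  (AlgEquiv.ofInjective f h.injective).symm.toAlgHom.comp
    (((mapDomainAlgHom K M (MulEquiv.inv C).toMonoidHom).comp f).codRestrict _ h.inv_mem_range)

theorem apply_antipodeHom (h : IsForm θ f) (d : D) :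
    f (h.antipodeHom d) = mapDomainAlgHom K M (MulEquiv.inv C).toMonoidHom (f d) :=
  congrArg Subtype.val ((AlgEquiv.ofInjective f h.injective).apply_symm_apply
    ⟨_, h.inv_mem_range d⟩)

theorem formTensor₃_tmul (f : D →ₐ[K] MonoidAlgebra M C) (a : D) (t : D ⊗[K] D) :
    formTensor₃ f (a ⊗ₜ t) = mapDomainAlgHom K M (MonoidHom.inl C (C × C)) (f a) *
      mapDomainAlgHom K M (MonoidHom.inr C (C × C)) (formTensor f f t) :=
  formTensor_tmul (B := D ⊗[K] D) (Z := C × C) f (formTensor f f) a t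

theorem formTensor₃_assoc (f : D →ₐ[K] MonoidAlgebra M C) (t : D ⊗[K] D) (b : D) :
    formTensor₃ f (Algebra.TensorProduct.assoc K K K D D D (t ⊗ₜ b)) =
      mapDomainAlgHom K M (MulEquiv.prodAssoc.toMonoidHom.comp (MonoidHom.inl (C × C) C))
        (formTensor f f t) *
      mapDomainAlgHom K M (MulEquiv.prodAssoc.toMonoidHom.comp (MonoidHom.inr (C × C) C))
        (f b) := by
  induction t with
  | zero => simp
  | add x y hx hy => rw [TensorProduct.add_tmul, map_add, map_add, hx, hy, map_add, map_add, add_mul]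
  | tmul x y =>
    rw [Algebra.TensorProduct.assoc_tmul, formTensor₃_tmul, formTensor_tmul, formTensor_tmul,
      map_mul, map_mul, mapDomainAlgHom_apply_comp, mapDomainAlgHom_apply_comp,
      mapDomainAlgHom_apply_comp, mapDomainAlgHom_apply_comp, mul_assoc]
    rfl

/-- Inside `M[C × (C × C)]` both sides are induced by group homomorphisms out of `C`, and both of
these send `c` to `(c, (c, c))`. -/
theorem coassoc (h : IsForm θ f) :
    (Algebra.TensorProduct.assoc K K K D D D).toAlgHom.comp
      ((Algebra.TensorProduct.map h.comulHom (.id K D)).comp h.comulHom) =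
    (Algebra.TensorProduct.map (.id K D) h.comulHom).comp h.comulHom := by
  have e₁ : (formTensor₃ f).comp ((Algebra.TensorProduct.assoc K K K D D D).toAlgHom.comp
        (Algebra.TensorProduct.map h.comulHom (.id K D))) =
      (mapDomainAlgHom K M ((MulEquiv.prodAssoc (M := C) (N := C) (P := C)).toMonoidHom.comp
        ((diagHom C).prodMap (MonoidHom.id C)))).comp (formTensor f f) := by
    refine Algebra.TensorProduct.ext' fun a b => ?_
    have h₁ := formTensor₃_assoc f (h.comulHom a) b
    rw [h.formTensor_comulHom, mapDomainAlgHom_apply_comp] at h₁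
    refine h₁.trans ?_
    rw [AlgHom.comp_apply, formTensor_tmul, map_mul, mapDomainAlgHom_apply_comp,
      mapDomainAlgHom_apply_comp]
    rfl
  have e₂ : (formTensor₃ f).comp (Algebra.TensorProduct.map (.id K D) h.comulHom) =
      (mapDomainAlgHom K M ((MonoidHom.id C).prodMap (diagHom C))).comp (formTensor f f) := by
    refine Algebra.TensorProduct.ext' fun a b => ?_
    have h₁ := formTensor₃_tmul f a (h.comulHom b)
    rw [h.formTensor_comulHom, mapDomainAlgHom_apply_comp] at h₁
    refine h₁.trans ?_
    rw [AlgHom.comp_apply, formTensor_tmul, map_mul, mapDomainAlgHom_apply_comp,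
      mapDomainAlgHom_apply_comp]
    rfl
  refine AlgHom.ext fun d => h.formTensor₃_injective ?_
  have h₁ := DFunLike.congr_fun e₁ (h.comulHom d)
  have h₂ := DFunLike.congr_fun e₂ (h.comulHom d)
  refine h₁.trans (Eq.trans ?_ h₂.symm)
  rw [AlgHom.comp_apply, AlgHom.comp_apply, formTensor_comulHom, mapDomainAlgHom_apply_comp,
    mapDomainAlgHom_apply_comp]
  rfl

theorem apply_algebraMap (f : D →ₐ[K] MonoidAlgebra M C) (k : K) :
    f (algebraMap K D k) = algebraMap K _ k := f.commutes k

theorem apply_counitHom_smul (h : IsForm θ f) (a b : D) :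
    f (h.counitHom a • b) = augHom K M C (f a) • f b := by
  rw [map_smul, ← h.algebraMap_counitHom, algebraMap_smul]

theorem mapDomainAlgHom_one {Z : Type*} [CommGroup Z] (ξ : MonoidAlgebra M C) :
    mapDomainAlgHom K M (1 : C →* Z) ξ = algebraMap M _ (augHom K M C ξ) := by
  induction ξ using MonoidAlgebra.induction_linear with
  | zero => simp
  | add ξ ξ' h h' => rw [map_add, map_add, map_add, h, h']
  | single y m =>
    rw [mapDomainAlgHom_single, augHom_single]
    rfl

theorem mapDomain_snd_mul (ξ η : MonoidAlgebra M C) :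
    mapDomainAlgHom K M (MonoidHom.snd C C)
      (mapDomainAlgHom K M (MonoidHom.inl C C) ξ * mapDomainAlgHom K M (MonoidHom.inr C C) η) =
    augHom K M C ξ • η := by
  rw [map_mul, mapDomainAlgHom_apply_comp, mapDomainAlgHom_apply_comp, MonoidHom.snd_comp_inl,
    MonoidHom.snd_comp_inr, mapDomainAlgHom_id, AlgHom.id_apply, mapDomainAlgHom_one,
    Algebra.smul_def]

theorem mapDomain_fst_mul (ξ η : MonoidAlgebra M C) :
    mapDomainAlgHom K M (MonoidHom.fst C C)
      (mapDomainAlgHom K M (MonoidHom.inl C C) ξ * mapDomainAlgHom K M (MonoidHom.inr C C) η) =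
    augHom K M C η • ξ := by
  rw [map_mul, mapDomainAlgHom_apply_comp, mapDomainAlgHom_apply_comp, MonoidHom.fst_comp_inl,
    MonoidHom.fst_comp_inr, mapDomainAlgHom_id, AlgHom.id_apply, mapDomainAlgHom_one,
    Algebra.smul_def, mul_comm]

theorem rTensor_counit (h : IsForm θ f) :
    (Algebra.TensorProduct.map h.counitHom (.id K D)).comp h.comulHom =
      (Algebra.TensorProduct.lid K D).symm := by
  have e : ∀ t, f (Algebra.TensorProduct.lid K D
      (Algebra.TensorProduct.map h.counitHom (.id K D) t)) =
      mapDomainAlgHom K M (MonoidHom.snd C C) (formTensor f f t) := by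
    intro t
    induction t with
    | zero => simp
    | add x y hx hy => simp only [map_add, hx, hy]
    | tmul a b =>
      rw [formTensor_tmul, mapDomain_snd_mul, ← h.apply_counitHom_smul]
      simp
  refine AlgHom.ext fun d => (Algebra.TensorProduct.lid K D).injective (h.injective ?_)
  refine (e _).trans ((congrArg _ (h.formTensor_comulHom d)).trans ?_)
  rw [mapDomainAlgHom_apply_comp]
  simp [diagHom]

theorem lTensor_counit (h : IsForm θ f) :
    (Algebra.TensorProduct.map (.id K D) h.counitHom).comp h.comulHom =
      (Algebra.TensorProduct.rid K K D).symm := by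
  have e : ∀ t, f (Algebra.TensorProduct.rid K K D
      (Algebra.TensorProduct.map (.id K D) h.counitHom t)) =
      mapDomainAlgHom K M (MonoidHom.fst C C) (formTensor f f t) := by
    intro t
    induction t with
    | zero => simp
    | add x y hx hy => simp only [map_add, hx, hy]
    | tmul a b =>
      rw [formTensor_tmul, mapDomain_fst_mul, ← h.apply_counitHom_smul]
      simp
  refine AlgHom.ext fun d => (Algebra.TensorProduct.rid K K D).injective (h.injective ?_)
  refine (e _).trans ((congrArg _ (h.formTensor_comulHom d)).trans ?_)
  rw [mapDomainAlgHom_apply_comp]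
  simp [diagHom]

/-- The bialgebra structure on a form of `M[C]`. -/
noncomputable abbrev bialgebra (h : IsForm θ f) : Bialgebra K D :=
  Bialgebra.ofAlgHom h.comulHom h.counitHom h.coassoc h.rTensor_counit h.lTensor_counit

/-- Multiplying after the diagonal induces `φ * χ` on `C`. Taking inversion and the identity, in
either order, gives the two antipode axioms. -/
theorem lift_comulHom (h : IsForm θ f) {S T : D →ₐ[K] D} (φ χ : C →* C)
    (hS : ∀ d, f (S d) = mapDomainAlgHom K M φ (f d))
    (hT : ∀ d, f (T d) = mapDomainAlgHom K M χ (f d)) (hφ : φ * χ = 1) (d : D) :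
    Algebra.TensorProduct.lift S T (fun _ _ => Commute.all _ _) (h.comulHom d) =
      algebraMap K D (h.counitHom d) := by
  have e : ∀ t, f (Algebra.TensorProduct.lift S T (fun _ _ => Commute.all _ _) t) =
      mapDomainAlgHom K M (φ.coprod χ) (formTensor f f t) := by
    intro t
    induction t with
    | zero => simp
    | add x y hx hy => simp only [map_add, hx, hy]
    | tmul a b =>
      rw [formTensor_tmul, Algebra.TensorProduct.lift_tmul, map_mul, map_mul, hS, hT,
        mapDomainAlgHom_apply_comp, mapDomainAlgHom_apply_comp, MonoidHom.coprod_comp_inl,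
        MonoidHom.coprod_comp_inr]
  have hd : (φ.coprod χ).comp (diagHom C) = 1 := by
    rw [← hφ]; rfl
  apply h.injective
  rw [e, h.formTensor_comulHom, mapDomainAlgHom_apply_comp, hd, mapDomainAlgHom_one,
    apply_algebraMap, ← h.algebraMap_counitHom]
  rfl

/-- The Hopf algebra structure on a form of `M[C]`. -/
noncomputable abbrev hopfAlgebra (h : IsForm θ f) : HopfAlgebra K D :=
  let _ := h.bialgebra
  HopfAlgebra.ofAlgHom h.antipodeHom
    (AlgHom.ext fun d => h.lift_comulHom (MulEquiv.inv C).toMonoidHom (.id C) h.apply_antipodeHom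
      (fun d => by simp) (by ext c; simp) d)
    (AlgHom.ext fun d => h.lift_comulHom (.id C) (MulEquiv.inv C).toMonoidHom
      (fun d => by simp) h.apply_antipodeHom (by ext c; simp) d)

theorem isCocomm (h : IsForm θ f) : letI := h.hopfAlgebra; Coalgebra.IsCocomm K D := by
  let _ := h.hopfAlgebra
  constructor
  have e : ∀ t, formTensor f f (TensorProduct.comm K D D t) =
      mapDomainAlgHom K M (MulEquiv.prodComm (M := C) (N := C)).toMonoidHom (formTensor f f t) := by
    intro t
    induction t with
    | zero => simp
    | add x y hx hy => simp only [map_add, hx, hy]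
    | tmul a b =>
      rw [TensorProduct.comm_tmul, formTensor_tmul, formTensor_tmul, map_mul,
        mapDomainAlgHom_apply_comp, mapDomainAlgHom_apply_comp, mul_comm]
      rfl
  refine LinearMap.ext fun d => h.formTensor_injective ?_
  refine (e (h.comulHom d)).trans (Eq.trans ?_ (h.formTensor_comulHom d).symm)
  rw [h.formTensor_comulHom, mapDomainAlgHom_apply_comp]
  rfl

theorem counit_eq_augHom (ξ : MonoidAlgebra M C) :
    Coalgebra.counit (R := M) ξ = augHom K M C ξ := by
  induction ξ using MonoidAlgebra.induction_linear with
  | zero => simp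
  | add ξ ξ' h h' => rw [map_add, map_add, h, h']
  | single y m => simp

/-- The map `M[C] ⊗ M[C] → M[C × C]`. -/
noncomputable def monoidAlgebraTensor (M C : Type*) [Field M] [CommGroup C] :
    MonoidAlgebra M C ⊗[M] MonoidAlgebra M C →ₐ[M] MonoidAlgebra M (C × C) :=
  formTensor (K := M) (M := M) (AlgHom.id M _) (AlgHom.id M _)

theorem monoidAlgebraTensor_injective : Function.Injective (monoidAlgebraTensor M C) := by
  have h : PreservesIndep (K := M) (M := M) (AlgHom.id M (MonoidAlgebra M C)).toLinearMap := by
    have : Module.Finite M (MonoidAlgebra M C) :=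
      Module.Finite.equiv (coeffLinearEquiv M : MonoidAlgebra M C ≃ₗ[M] C →₀ M).symm
    exact ⟨_, Module.finBasis M (MonoidAlgebra M C),
      (Module.finBasis M (MonoidAlgebra M C)).linearIndependent⟩
  exact (h.formTensor h).injective

theorem monoidAlgebraTensor_comul (ξ : MonoidAlgebra M C) :
    monoidAlgebraTensor M C (Coalgebra.comul (R := M) ξ) =
      mapDomainAlgHom K M (diagHom C) ξ := by
  induction ξ using MonoidAlgebra.induction_linear with
  | zero => simp
  | add ξ ξ' h h' => rw [map_add, map_add, map_add, h, h']
  | single y m =>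
    rw [MonoidAlgebra.comul_single, mapDomainAlgHom_single, CommSemiring.comul_apply,
      TensorProduct.map_tmul, monoidAlgebraTensor, formTensor_tmul]
    simp [diagHom, single_mul_single]

/-- A form of `M[C]` becomes isomorphic to `M[C]` over `M`. -/
noncomputable def baseChangeEquiv (h : IsForm θ f) :
    letI := h.hopfAlgebra; (M ⊗[K] D) ≃ₐc[M] MonoidAlgebra M C :=
  letI := h.hopfAlgebra
  BialgEquiv.ofAlgEquiv (AlgEquiv.ofBijective (baseChangeHom f) h.baseChangeHom_bijective)
    (by
      refine Algebra.TensorProduct.ext (by ext) (AlgHom.ext fun d => ?_)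
      change Coalgebra.counit (R := M) (baseChangeHom f (1 ⊗ₜ d)) = h.counitHom d • (1 : M)
      rw [baseChangeHom_tmul, one_smul, counit_eq_augHom (K := K), ← h.algebraMap_counitHom,
        Algebra.smul_def, mul_one])
    (by
      refine Algebra.TensorProduct.ext (by ext) (AlgHom.ext fun d => ?_)
      apply monoidAlgebraTensor_injective
      have e : ∀ t : D ⊗[K] D, monoidAlgebraTensor M C (Algebra.TensorProduct.map
          (baseChangeHom f) (baseChangeHom f)
          (TensorProduct.AlgebraTensorModule.tensorTensorTensorComm K M K M M M D D
            (((1 : M) ⊗ₜ[M] (1 : M)) ⊗ₜ[K] t))) = formTensor f f t := by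
        intro t
        induction t with
        | zero => simp
        | add x y hx hy => rw [TensorProduct.tmul_add, map_add, map_add, map_add, hx, hy, map_add]
        | tmul a b =>
          simp [monoidAlgebraTensor, formTensor_tmul]
      refine (e (h.comulHom d)).trans ((h.formTensor_comulHom d).trans ?_)
      refine Eq.trans ?_ (monoidAlgebraTensor_comul (K := K) (baseChangeHom f (1 ⊗ₜ d))).symm
      rw [baseChangeHom_tmul, one_smul])

end IsForm

end FormHopf

/-! ### Hopf Galois structures as spaces of families of linear maps indexed by the embeddings. -/

namespace HopfGaloisStructure

variable {K : Type u} {L : Type v} {M : Type w} [Field K] [Field L] [Field M]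
  [Algebra K L] [Algebra K M]

/-- The map `L ⊗ H → End_K(L)` of a Hopf Galois structure. -/
noncomputable def galoisMap (S : HopfGaloisStructure K L) :
    L ⊗[K] S.H →ₗ[K] Module.End K L :=
  TensorProduct.lift ((LinearMap.mul K (Module.End K L)).compl₁₂
      (Algebra.lmul K L).toLinearMap S.μ.toLinearMap)

theorem galoisMap_bijective (S : HopfGaloisStructure K L) : Function.Bijective S.galoisMap :=
  S.galois

@[simp] theorem galoisMap_tmul (S : HopfGaloisStructure K L) (l : L) (h : S.H) (y : L) :
    S.galoisMap (l ⊗ₜ h) y = l * S.μ h y := by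
  simp [galoisMap]

theorem μ_injective (S : HopfGaloisStructure K L) : Function.Injective S.μ := by
  intro h h' hh
  have h1 : S.galoisMap (1 ⊗ₜ h) = S.galoisMap (1 ⊗ₜ h') := by
    ext y; simp [hh]
  have h2 := S.galoisMap_bijective.1 h1
  have h3 : Function.Injective fun h : S.H => (1 : L) ⊗ₜ[K] h :=
    Algebra.TensorProduct.includeRight_injective (algebraMap K L).injective
  exact h3 h2

/-- The `M`-linear map `M ⊗ H → Hom_K(L, M)`, `m ⊗ h ↦ m (x ∘ h)`, attached to an embedding `x`. -/
noncomputable def evTensor (S : HopfGaloisStructure K L) (x : L →ₐ[K] M) :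
    M ⊗[K] S.H →ₗ[M] (L →ₗ[K] M) :=
  LinearMap.liftBaseChange M (LinearMap.compRight K x.toLinearMap ∘ₗ S.μ.toLinearMap)

@[simp] theorem evTensor_tmul (S : HopfGaloisStructure K L) (x : L →ₐ[K] M) (m : M) (h : S.H)
    (l : L) : S.evTensor x (m ⊗ₜ h) l = m * x (S.μ h l) := by
  simp [evTensor]

/-- The bilinear map `(x, y) ↦ ∑ (h₁ · x) (h₂ · y)` attached to an element of `H ⊗ H`. -/
noncomputable def actTwo (S : HopfGaloisStructure K L) (x y : L) : S.H ⊗[K] S.H →ₗ[K] L :=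
  LinearMap.mul' K L ∘ₗ
    TensorProduct.map (S.μ.toLinearMap.flip x) (S.μ.toLinearMap.flip y)

@[simp] theorem actTwo_tmul (S : HopfGaloisStructure K L) (x y : L) (h h' : S.H) :
    S.actTwo x y (h ⊗ₜ h') = S.μ h x * S.μ h' y := by
  simp [actTwo]

section Finite

variable [FiniteDimensional K L]

theorem finrank_H (S : HopfGaloisStructure K L) : Module.finrank K S.H = Module.finrank K L := by
  have h := (LinearEquiv.ofBijective S.galoisMap S.galoisMap_bijective).finrank_eq
  rw [Module.finrank_tensorProduct, Module.finrank_linearMap] at h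
  exact Nat.eq_of_mul_eq_mul_left Module.finrank_pos h

theorem evTensor_galoisMap (S : HopfGaloisStructure K L) (x : L →ₐ[K] M) (t : L ⊗[K] S.H) :
    S.evTensor x (TensorProduct.map x.toLinearMap LinearMap.id t) =
      x.toLinearMap ∘ₗ S.galoisMap t := by
  induction t with
  | zero => simp
  | add a b ha hb => rw [map_add, map_add, map_add, ha, hb, LinearMap.comp_add]
  | tmul l h => ext y; simp

/-- The `K`-valued coordinate functionals, viewed as endomorphisms of `L`, lie in the image of the
Galois map; composed with `x` they span `Hom_K(L, M)` over `M`. Injectivity follows from equality of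
dimensions. -/
theorem evTensor_bijective (S : HopfGaloisStructure K L) (x : L →ₐ[K] M) :
    Function.Bijective (S.evTensor x) := by
  have hr : Module.finrank M (M ⊗[K] S.H) = Module.finrank M (L →ₗ[K] M) := by
    rw [Module.finrank_baseChange, S.finrank_H, Module.finrank_linearMap_self]
  have hs : Function.Surjective (S.evTensor x) := by
    rw [← LinearMap.range_eq_top, eq_top_iff]
    intro φ _
    let b := Module.finBasis K L
    have hφ : φ = ∑ i, φ (b i) • (x.toLinearMap ∘ₗ
        (LinearMap.toSpanSingleton K L 1 ∘ₗ b.coord i)) := by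
      refine b.ext fun j => ?_
      simp [Finsupp.single_apply]
    rw [hφ]
    refine Submodule.sum_mem _ fun i _ => Submodule.smul_mem _ _ ?_
    obtain ⟨t, ht⟩ := S.galoisMap_bijective.2 (LinearMap.toSpanSingleton K L 1 ∘ₗ b.coord i)
    exact ⟨_, (S.evTensor_galoisMap x t).trans (by rw [ht])⟩
  exact ⟨(LinearMap.injective_iff_surjective_of_finrank_eq_finrank hr).mpr hs, hs⟩

/-- Apply injectivity of the Galois map with the first argument `x` held fixed, then injectivity of
`μ`. Consequently the comultiplication is determined by the action on products. -/
theorem eq_zero_of_actTwo (S : HopfGaloisStructure K L) (t : S.H ⊗[K] S.H)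
    (ht : ∀ x y, S.actTwo x y t = 0) : t = 0 := by
  let b := Module.finBasis K S.H
  obtain ⟨a, rfl⟩ := TensorProduct.eq_repr_basis_right b t
  have key : ∀ x i, S.μ (a i) x = 0 := by
    intro x
    have h0 : S.galoisMap (a.sum fun i c => S.μ c x ⊗ₜ b i) = 0 := by
      ext y
      have := ht x y
      simp only [Finsupp.sum, map_sum, actTwo_tmul] at this
      simpa [Finsupp.sum] using this
    have h1 := S.galoisMap_bijective.1 (h0.trans (map_zero _).symm)
    intro i
    have h2 := TensorProduct.sum_tmul_basis_right_eq_zero b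
      (a.mapRange (fun c => S.μ c x) (by simp)) (by
        rw [Finsupp.sum_mapRange_index (by simp)]; exact h1)
    simpa using DFunLike.congr_fun h2 i
  have ha : a = 0 := by
    ext i
    apply S.μ_injective
    ext x
    simpa using key x i
  simp [ha]

/-- Since `μ` is injective, `H` is its image as an algebra. The counit is read off from the action
on `1` and the comultiplication from the action on products, so nothing else is needed. -/
theorem iso_of_range_eq {S T : HopfGaloisStructure K L} (h : S.μ.range = T.μ.range) :
    S.Iso T := by
  let f : S.H ≃ₐ[K] T.H := ((AlgEquiv.ofInjective S.μ S.μ_injective).trans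
    (Subalgebra.equivOfEq _ _ h)).trans (AlgEquiv.ofInjective T.μ T.μ_injective).symm
  have hf : ∀ a, T.μ (f a) = S.μ a := fun a =>
    congrArg Subtype.val ((AlgEquiv.ofInjective T.μ T.μ_injective).apply_symm_apply _)
  refine ⟨BialgEquiv.ofAlgEquiv f ?_ ?_, hf⟩
  · refine AlgHom.ext fun a => (algebraMap K L).injective ?_
    change algebraMap K L (Coalgebra.counit (f a)) = algebraMap K L (Coalgebra.counit a)
    rw [← T.act_one, ← S.act_one, hf]
  · refine AlgHom.ext fun a => ?_
    change Algebra.TensorProduct.map (f : S.H →ₐ[K] T.H) (f : S.H →ₐ[K] T.H)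
      (Coalgebra.comul a) = Coalgebra.comul (f a)
    rw [← sub_eq_zero]
    refine T.eq_zero_of_actTwo _ fun x y => ?_
    have e : ∀ t, T.actTwo x y (Algebra.TensorProduct.map (f : S.H →ₐ[K] T.H)
        (f : S.H →ₐ[K] T.H) t) = S.actTwo x y t := by
      intro t
      induction t with
      | zero => simp
      | add a b ha hb => rw [map_add, map_add, map_add, ha, hb]
      | tmul a b => simp [hf]
    rw [map_sub, e, sub_eq_zero]
    exact (S.act_mul a x y).symm.trans ((congrArg (fun φ => φ (x * y)) (hf a)).symm.trans
      (T.act_mul (f a) x y))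

theorem range_eq_of_iso {S T : HopfGaloisStructure K L} (h : S.Iso T) :
    S.μ.range = T.μ.range := by
  obtain ⟨f, hf⟩ := h
  ext φ
  constructor
  · rintro ⟨a, rfl⟩
    exact ⟨f a, hf a⟩
  · rintro ⟨a, rfl⟩
    refine ⟨f.symm a, ?_⟩
    change S.μ (f.symm a) = T.μ a
    rw [← hf, BialgEquiv.apply_symm_apply]

end Finite

/-- The `M`-space of families `x ↦ x ∘ h`, for `h ∈ M ⊗ H`, indexed by the embeddings. -/
noncomputable def embSpace (M : Type w) [Field M] [Algebra K M] (S : HopfGaloisStructure K L) :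
    Submodule M ((L →ₐ[K] M) → (L →ₗ[K] M)) :=
  LinearMap.range (LinearMap.pi fun x => S.evTensor x)

theorem embSpace_eq_span (S : HopfGaloisStructure K L) : S.embSpace M =
    Submodule.span M ((fun (φ : Module.End K L) (x : L →ₐ[K] M) => x.toLinearMap ∘ₗ φ) ''
      (S.μ.range : Set (Module.End K L))) := by
  apply le_antisymm
  · rintro _ ⟨t, rfl⟩
    induction t with
    | zero => simp
    | add a b ha hb => rw [map_add]; exact Submodule.add_mem _ ha hb
    | tmul m h =>
      have : (LinearMap.pi fun x : L →ₐ[K] M => S.evTensor x) (m ⊗ₜ h) =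
          m • fun x : L →ₐ[K] M => x.toLinearMap ∘ₗ S.μ h := by
        ext x l; simp
      rw [this]
      exact Submodule.smul_mem _ _ (Submodule.subset_span ⟨_, ⟨h, rfl⟩, rfl⟩)
  · rw [Submodule.span_le]
    rintro _ ⟨_, ⟨h, rfl⟩, rfl⟩
    refine ⟨1 ⊗ₜ h, ?_⟩
    ext x l; simp

variable [Algebra.IsSeparable K L] [IsNormalClosure K L M] [FiniteDimensional K L]

/-- Descent from `M` to `K`. Let `φ` be the image of `∑ a i ⊗ b i` under the Galois map. If a single
`ξ` represents `x ∘ φ` for all `x`, comparing coordinates shows that `x (a i)` does not depend on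
`x`; it is then Galois invariant, so `a i` lies in `K` and `φ` in the image of `H`. -/
theorem mem_range_iff (S : HopfGaloisStructure K L) (φ : Module.End K L) :
    φ ∈ S.μ.range ↔ (fun x : L →ₐ[K] M => x.toLinearMap ∘ₗ φ) ∈ S.embSpace M := by
  have := finiteDimensional_of_isNormalClosure K L M
  have := isGalois_of_isNormalClosure K L M
  constructor
  · intro h
    rw [embSpace_eq_span]
    exact Submodule.subset_span ⟨φ, h, rfl⟩
  rintro ⟨ξ, hξ⟩
  obtain ⟨t, rfl⟩ := S.galoisMap_bijective.2 φ
  let b := Module.finBasis K S.H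
  obtain ⟨a, rfl⟩ := TensorProduct.eq_repr_basis_right b t
  have hx : ∀ x : L →ₐ[K] M,
      TensorProduct.map x.toLinearMap LinearMap.id (a.sum fun i c => c ⊗ₜ b i) = ξ := by
    intro x
    apply (S.evTensor_bijective x).1
    rw [evTensor_galoisMap]
    exact (congrFun hξ x).symm
  have hxi : ∀ (x y : L →ₐ[K] M) i, x (a i) = y (a i) := by
    intro x y i
    have hc : ∀ z : L →ₐ[K] M, TensorProduct.equivFinsuppOfBasisRight b ξ i = z (a i) := by
      intro z
      rw [← hx z]
      simp [Finsupp.sum_fintype, Finsupp.single_apply]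
    rw [← hc, ← hc]
  have hk : ∀ i, ∃ k : K, algebraMap K L k = a i := by
    intro i
    obtain ⟨x⟩ := nonempty_embeddings K L M
    have : x (a i) ∈ (⊥ : IntermediateField K M) := by
      rw [IsGalois.mem_bot_iff_fixed]
      intro σ
      exact hxi (embPerm K L M σ x) x i
    obtain ⟨k, hk⟩ := this
    exact ⟨k, x.injective ((x.commutes k).trans hk)⟩
  choose k hk using hk
  refine ⟨∑ i, k i • b i, ?_⟩
  ext y
  simp [Finsupp.sum_fintype, ← hk, Algebra.smul_def]

theorem iso_iff_embSpace_eq (S T : HopfGaloisStructure K L) :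
    S.Iso T ↔ S.embSpace M = T.embSpace M := by
  constructor
  · intro h
    rw [embSpace_eq_span, embSpace_eq_span, range_eq_of_iso h]
  · intro h
    apply iso_of_range_eq
    ext φ
    rw [mem_range_iff (M := M), mem_range_iff (M := M), h]

end HopfGaloisStructure

/-! ### Regular representations normalised by a group action -/

section RegNormalized

variable {G X C : Type*} [Group G] [CommGroup C]

/-- `ρ` is a regular action of `C` on `X` whose image is normalised by the action `a` of `G`. -/
structure IsRegNormalized (a : G →* Equiv.Perm X) (ρ : C →* Equiv.Perm X) : Prop where
  bijective : ∀ x, Function.Bijective fun c => ρ c x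
  conj_mem : ∀ σ c, ∃ c', a σ * ρ c * (a σ)⁻¹ = ρ c'

theorem IsRegNormalized.injective [Nonempty X] {a : G →* Equiv.Perm X} {ρ : C →* Equiv.Perm X}
    (h : IsRegNormalized a ρ) : Function.Injective ρ := by
  obtain ⟨x⟩ := ‹Nonempty X›
  intro c c' hc
  exact (h.bijective x).1 (congrArg (fun π : Equiv.Perm X => π x) hc)

/-- The conjugation action of `G` on `C`. -/
theorem IsRegNormalized.exists_conj [Nonempty X] {a : G →* Equiv.Perm X} {ρ : C →* Equiv.Perm X}
    (h : IsRegNormalized a ρ) :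
    ∃ θ : G →* MulAut C, ∀ σ c, ρ (θ σ c) = a σ * ρ c * (a σ)⁻¹ := by
  choose g hg using h.conj_mem
  have inj := h.injective
  have g_mul : ∀ σ τ c, g (σ * τ) c = g σ (g τ c) := by
    intro σ τ c
    apply inj
    rw [← hg, ← hg, ← hg, map_mul]
    group
  have g_one : ∀ c, g 1 c = c := by
    intro c
    apply inj
    rw [← hg, map_one]
    group
  refine ⟨{ toFun := fun σ =>
              { toFun := g σ
                invFun := g σ⁻¹
                left_inv := fun c => by rw [← g_mul, inv_mul_cancel, g_one]
                right_inv := fun c => by rw [← g_mul, mul_inv_cancel, g_one]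
                map_mul' := fun c c' => inj (by
                  rw [map_mul, ← hg, ← hg, ← hg, map_mul]; group) }
            map_one' := MulEquiv.ext g_one
            map_mul' := fun σ τ => MulEquiv.ext (g_mul σ τ) }, fun σ c => (hg σ c).symm⟩

theorem IsRegNormalized.apply_comm [Nonempty X] {a : G →* Equiv.Perm X} {ρ : C →* Equiv.Perm X}
    {θ : G →* MulAut C} (hθ : ∀ σ c, ρ (θ σ c) = a σ * ρ c * (a σ)⁻¹) (σ : G) (c : C) (x : X) :
    ρ (θ σ c) (a σ x) = a σ (ρ c x) := by
  rw [hθ]; simp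

end RegNormalized

/-! ### The subspace spanned by a regular group of permutations of the embeddings. -/

section PermEv

open MonoidAlgebra

variable {K : Type u} {L : Type v} {M : Type w} [Field K] [Field L] [Field M]
  [Algebra K L] [Algebra K M] {C : Type*} [CommGroup C]

/-- The linear extension of `c ↦ ρ c x` to the group algebra. -/
noncomputable def permEv (ρ : C →* Equiv.Perm (L →ₐ[K] M)) (x : L →ₐ[K] M) :
    MonoidAlgebra M C →ₗ[M] (L →ₗ[K] M) :=
  Finsupp.linearCombination M (fun c => (ρ c x).toLinearMap) ∘ₗ
    (coeffLinearEquiv M : MonoidAlgebra M C ≃ₗ[M] C →₀ M).toLinearMap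

@[simp] theorem permEv_single (ρ : C →* Equiv.Perm (L →ₐ[K] M)) (x : L →ₐ[K] M) (c : C) (m : M) :
    permEv ρ x (single c m) = m • (ρ c x).toLinearMap := by
  simp [permEv]

theorem permEv_injective {ρ : C →* Equiv.Perm (L →ₐ[K] M)} (x : L →ₐ[K] M)
    (h : Function.Injective fun c => ρ c x) : Function.Injective (permEv ρ x) := by
  have hli : LinearIndependent M fun c => (ρ c x).toLinearMap :=
    (linearIndependent_algHom_toLinearMap K L M).comp _ h
  exact Function.Injective.comp (g := Finsupp.linearCombination M _) hli
    (LinearEquiv.injective _)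

/-- The span of the families `x ↦ ρ c x`. -/
noncomputable def permSpace (ρ : C →* Equiv.Perm (L →ₐ[K] M)) :
    Submodule M ((L →ₐ[K] M) → (L →ₗ[K] M)) :=
  LinearMap.range (LinearMap.pi fun x => permEv ρ x)

/-- The same coefficients `ξ` serve every `x`. At one `x₀`, linear independence of distinct
embeddings forces `ξ` to be a single group element, which then gives `π` everywhere. Hence the span
determines the group. -/
theorem exists_eq_of_mem_permSpace {ρ : C →* Equiv.Perm (L →ₐ[K] M)}
    (hρ : ∀ x, Function.Bijective fun c => ρ c x) [Nonempty (L →ₐ[K] M)]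
    {π : (L →ₐ[K] M) → (L →ₐ[K] M)} (hπ : (fun x => (π x).toLinearMap) ∈ permSpace ρ) :
    ∃ c, ∀ x, π x = ρ c x := by
  obtain ⟨ξ, hξ⟩ := hπ
  have hx : ∀ x, permEv ρ x ξ = (π x).toLinearMap := fun x => congrFun hξ x
  obtain ⟨x₀⟩ := ‹Nonempty (L →ₐ[K] M)›
  obtain ⟨c, hc⟩ := (hρ x₀).2 (π x₀)
  refine ⟨c, fun x => ?_⟩
  have h1 : ξ = single c 1 := by
    apply permEv_injective x₀ (hρ x₀).1
    rw [hx, permEv_single, one_smul, ← hc]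
  apply AlgHom.toLinearMap_injective
  rw [← hx, h1, permEv_single, one_smul]

theorem mem_permSpace (ρ : C →* Equiv.Perm (L →ₐ[K] M)) (c : C) :
    (fun x => (ρ c x).toLinearMap) ∈ permSpace ρ :=
  ⟨single c 1, by ext x l; simp⟩

theorem permSpace_eq_span (ρ : C →* Equiv.Perm (L →ₐ[K] M)) : permSpace ρ =
    Submodule.span M ((fun (π : Equiv.Perm (L →ₐ[K] M)) x => (π x).toLinearMap) ''
      (ρ.range : Set (Equiv.Perm (L →ₐ[K] M)))) := by
  apply le_antisymm
  · rintro _ ⟨ξ, rfl⟩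
    induction ξ using MonoidAlgebra.induction_linear with
    | zero => simp
    | add ξ ξ' h h' => rw [map_add]; exact Submodule.add_mem _ h h'
    | single c m =>
      have : (LinearMap.pi fun x => permEv ρ x) (single c m) =
          m • fun x => (ρ c x).toLinearMap := by
        ext x l; simp
      rw [this]
      exact Submodule.smul_mem _ _ (Submodule.subset_span ⟨_, ⟨c, rfl⟩, rfl⟩)
  · rw [Submodule.span_le]
    rintro _ ⟨_, ⟨c, rfl⟩, rfl⟩
    exact mem_permSpace ρ c

theorem permSpace_eq_iff [Nonempty (L →ₐ[K] M)] {ρ ρ' : C →* Equiv.Perm (L →ₐ[K] M)}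
    (hρ : ∀ x, Function.Bijective fun c => ρ c x)
    (hρ' : ∀ x, Function.Bijective fun c => ρ' c x) :
    permSpace ρ = permSpace ρ' ↔ ρ.range = ρ'.range := by
  constructor
  · intro h
    apply le_antisymm
    · rintro _ ⟨c, rfl⟩
      obtain ⟨c', hc'⟩ := exists_eq_of_mem_permSpace hρ' (h ▸ mem_permSpace ρ c)
      exact ⟨c', Equiv.ext fun x => (hc' x).symm⟩
    · rintro _ ⟨c, rfl⟩
      obtain ⟨c', hc'⟩ := exists_eq_of_mem_permSpace hρ (h ▸ mem_permSpace ρ' c)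
      exact ⟨c', Equiv.ext fun x => (hc' x).symm⟩
  · intro h
    rw [permSpace_eq_span, permSpace_eq_span, h]

end PermEv

/-! ### The permutations attached to a Hopf Galois structure -/

namespace HopfGaloisStructure

open MonoidAlgebra

variable {K : Type u} {L : Type v} {M : Type w} [Field K] [Field L] [Field M]
  [Algebra K L] [Algebra K M] (S : HopfGaloisStructure K L)

theorem evTensor_mul_tmul (x : L →ₐ[K] M) (ξ : M ⊗[K] S.H) (m : M) (h : S.H) :
    S.evTensor x (ξ * (m ⊗ₜ h)) = m • (S.evTensor x ξ ∘ₗ S.μ h) := by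
  induction ξ with
  | zero => simp
  | add a b ha hb => rw [add_mul, map_add, map_add, ha, hb, LinearMap.add_comp, smul_add]
  | tmul m' h' =>
    ext l
    simp [Algebra.TensorProduct.tmul_mul_tmul, mul_assoc, mul_left_comm]

/-- The composition law which turns the multiplication of group-like elements into composition of
permutations of the embeddings. -/
theorem evTensor_mul (x y : L →ₐ[K] M) (ξ η : M ⊗[K] S.H)
    (hy : S.evTensor x ξ = y.toLinearMap) : S.evTensor x (ξ * η) = S.evTensor y η := by
  induction η with
  | zero => simp
  | add a b ha hb => rw [mul_add, map_add, map_add, ha, hb]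
  | tmul m h =>
    rw [evTensor_mul_tmul, hy]
    ext l; simp

theorem evTensor_apply_one (x : L →ₐ[K] M) (ξ : M ⊗[K] S.H) :
    S.evTensor x ξ 1 = Coalgebra.counit (R := M) ξ := by
  induction ξ with
  | zero => simp
  | add a b ha hb => rw [map_add, map_add, LinearMap.add_apply, ha, hb]
  | tmul m h => simp [S.act_one, Algebra.smul_def, mul_comm]

/-- The map `ξ ↦ S.evTensor x ξ l`. -/
noncomputable def evTensorAt (x : L →ₐ[K] M) (l : L) : M ⊗[K] S.H →ₗ[M] M where
  toFun ξ := S.evTensor x ξ l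
  map_add' ξ η := by simp
  map_smul' m ξ := by simp

theorem evTensor_apply_mul (x : L →ₐ[K] M) (ξ : M ⊗[K] S.H) (a b : L) :
    S.evTensor x ξ (a * b) = LinearMap.mul' M M
      (TensorProduct.map (S.evTensorAt x a) (S.evTensorAt x b) (Coalgebra.comul (R := M) ξ)) := by
  induction ξ with
  | zero => simp
  | add ξ η hξ hη => rw [map_add, map_add, LinearMap.add_apply, hξ, hη, map_add, map_add]
  | tmul m h =>
    have e : ∀ t : S.H ⊗[K] S.H, LinearMap.mul' M M
        (TensorProduct.map (S.evTensorAt x a) (S.evTensorAt x b)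
          (TensorProduct.AlgebraTensorModule.tensorTensorTensorComm K M K M M M S.H S.H
            (((1 : M) ⊗ₜ[M] m) ⊗ₜ[K] t))) = m * x (S.actTwo a b t) := by
      intro t
      induction t with
      | zero => simp
      | add t t' h h' =>
        rw [TensorProduct.tmul_add, map_add, map_add, map_add, h, h', map_add, map_add, mul_add]
      | tmul h h' =>
        rw [actTwo_tmul]
        simp [evTensorAt, mul_left_comm]
    rw [TensorProduct.comul_tmul, CommSemiring.comul_apply, e, evTensor_tmul, S.act_mul]
    rfl

/-- The module algebra axioms express the values at `1` and at products through the counit and the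
comultiplication of `ξ`; for a group-like element they say that the linear map is unital and
multiplicative. -/
theorem exists_algHom_of_isGroupLikeElem {ξ : M ⊗[K] S.H} (hξ : IsGroupLikeElem M ξ)
    (x : L →ₐ[K] M) : ∃ y : L →ₐ[K] M, y.toLinearMap = S.evTensor x ξ := by
  refine ⟨AlgHom.ofLinearMap (S.evTensor x ξ) ?_ ?_, ?_⟩
  · rw [evTensor_apply_one, hξ.counit_eq_one]
  · intro a b
    rw [evTensor_apply_mul, hξ.comul_eq_tmul_self]
    simp [evTensorAt]
  · rfl

theorem evTensor_conj (σ : M ≃ₐ[K] M) (x : L →ₐ[K] M) (ξ : M ⊗[K] S.H) (l : L) :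
    S.evTensor (embPerm K L M σ x)
      (TensorProduct.map σ.toLinearMap (LinearMap.id : S.H →ₗ[K] S.H) ξ) l =
      σ (S.evTensor x ξ l) := by
  induction ξ with
  | zero => simp
  | add a b ha hb => simp only [map_add, LinearMap.add_apply, ha, hb]
  | tmul m h => simp

variable [Algebra.IsSeparable K L] [IsNormalClosure K L M] [FiniteDimensional K L]

/-- The elements of `C`, carried to `M ⊗ H`, are group-like and so permute the embeddings. The
action is regular because `evTensor` is injective at each embedding and the cardinalities agree. It
is normalised because applying `σ` to the factor `M` of `M ⊗ H` corresponds to conjugation by `σ`,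
so a conjugate stays in the span and therefore in the group. -/
theorem exists_isRegNormalized {C : Type*} [CommGroup C] [Finite C]
    (hC : Nat.card C = Module.finrank K L) (hS : S.IsOfType M C) :
    ∃ ρ : C →* Equiv.Perm (L →ₐ[K] M), IsRegNormalized (embPerm K L M) ρ ∧
      S.embSpace M = permSpace ρ := by
  obtain ⟨Φ⟩ := hS
  have hne := nonempty_embeddings K L M
  let u : C → M ⊗[K] S.H := fun c => Φ.symm (single c 1)
  have hu : ∀ c, IsGroupLikeElem M (u c) := fun c =>
    (MonoidAlgebra.isGroupLikeElem_single_one c).map Φ.symm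
  have hmul : ∀ c c', u (c * c') = u c * u c' := by
    intro c c'
    simp only [u]
    rw [← map_mul, single_mul_single, mul_one]
  have hone : u 1 = 1 := by
    simp only [u]
    rw [← MonoidAlgebra.one_def, map_one]
  choose y hy using fun c => S.exists_algHom_of_isGroupLikeElem (hu c)
  have y_mul : ∀ c c' x, y (c * c') x = y c (y c' x) := by
    intro c c' x
    apply AlgHom.toLinearMap_injective
    -- `evTensor_mul` composes in the opposite order; commutativity of `C` turns the right action
    -- into a left one.
    rw [hy, hy, mul_comm, hmul, S.evTensor_mul x _ _ _ (hy c' x).symm]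
  have y_one : ∀ x, y 1 x = x := by
    intro x
    apply AlgHom.toLinearMap_injective
    rw [hy, hone]
    ext l
    simp [Algebra.TensorProduct.one_def]
  let ρ : C →* Equiv.Perm (L →ₐ[K] M) :=
    { toFun := fun c =>
        { toFun := y c
          invFun := y c⁻¹
          left_inv := fun x => by rw [← y_mul, inv_mul_cancel, y_one]
          right_inv := fun x => by rw [← y_mul, mul_inv_cancel, y_one] }
      map_one' := Equiv.ext y_one
      map_mul' := fun c c' => Equiv.ext (y_mul c c') }
  have hev : ∀ x ξ, S.evTensor x (Φ.symm ξ) = permEv ρ x ξ := by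
    intro x ξ
    induction ξ using MonoidAlgebra.induction_linear with
    | zero => simp
    | add ξ ξ' h h' => simp only [map_add, h, h']
    | single c m =>
      have hs : (single c m : MonoidAlgebra M C) = m • single c 1 := by simp
      rw [hs, map_smul, map_smul, map_smul, permEv_single, one_smul]
      exact congrArg _ (hy c x).symm
  have hspace : S.embSpace M = permSpace ρ := by
    apply le_antisymm
    · rintro _ ⟨t, rfl⟩
      refine ⟨Φ t, ?_⟩
      funext x
      change permEv ρ x (Φ t) = S.evTensor x t
      rw [← hev, BialgEquiv.symm_apply_apply]
    · rintro _ ⟨ξ, rfl⟩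
      exact ⟨Φ.symm ξ, funext fun x => hev x ξ⟩
  have hreg : ∀ x, Function.Bijective fun c => ρ c x := by
    intro x
    have := Fintype.ofFinite C
    rw [Fintype.bijective_iff_injective_and_card]
    constructor
    · intro c c' hc
      have h1 : S.evTensor x (u c) = S.evTensor x (u c') := by
        rw [← hy, ← hy]
        exact congrArg AlgHom.toLinearMap hc
      have h2 := Φ.symm.injective ((S.evTensor_bijective x).1 h1)
      exact MonoidAlgebra.single_left_injective one_ne_zero h2
    · rw [← Nat.card_eq_fintype_card, ← Nat.card_eq_fintype_card, hC, card_embeddings]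
  refine ⟨ρ, ⟨hreg, fun σ c => ?_⟩, hspace⟩
  have hmem : (fun x => ((embPerm K L M σ * ρ c * (embPerm K L M σ)⁻¹) x).toLinearMap) ∈
      permSpace ρ := by
    rw [← hspace]
    refine ⟨TensorProduct.map σ.toLinearMap (LinearMap.id : S.H →ₗ[K] S.H) (u c), ?_⟩
    funext x
    ext l
    have h1 := S.evTensor_conj σ ((embPerm K L M σ)⁻¹ x) (u c) l
    rw [← Equiv.Perm.mul_apply, mul_inv_cancel, Equiv.Perm.one_apply, ← hy] at h1
    exact h1
  obtain ⟨c', hc'⟩ := exists_eq_of_mem_permSpace hreg hmem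
  exact ⟨c', Equiv.ext hc'⟩

end HopfGaloisStructure

/-! ### The Hopf Galois structure attached to a regular representation -/

section Construction

open MonoidAlgebra

variable {K : Type u} {L : Type v} {M : Type w} [Field K] [Field L] [Field M]
  [Algebra K L] [Algebra K M] {C : Type*} [CommGroup C]

theorem permEv_mul_single (ρ : C →* Equiv.Perm (L →ₐ[K] M)) (x : L →ₐ[K] M)
    (ξ : MonoidAlgebra M C) (c : C) (m : M) :
    permEv ρ x (ξ * single c m) = m • permEv ρ (ρ c x) ξ := by
  induction ξ using MonoidAlgebra.induction_linear with
  | zero => simp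
  | add ξ ξ' h h' => rw [add_mul, map_add, map_add, h, h', smul_add]
  | single c' m' =>
    rw [single_mul_single, permEv_single, permEv_single, map_mul, mul_comm m', mul_smul]
    rfl

/-- Here `l'` plays the role of `ξ · l`; this is the associativity of the action constructed below.
-/
theorem permEv_apply_of_forall (ρ : C →* Equiv.Perm (L →ₐ[K] M)) {ξ : MonoidAlgebra M C}
    {l l' : L} (h : ∀ x, x l' = permEv ρ x ξ l) (x : L →ₐ[K] M) (η : MonoidAlgebra M C) :
    permEv ρ x η l' = permEv ρ x (ξ * η) l := by
  induction η using MonoidAlgebra.induction_linear with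
  | zero => simp
  | add η η' h h' => rw [mul_add, map_add, map_add, LinearMap.add_apply, h, h', LinearMap.add_apply]
  | single c m =>
    rw [permEv_mul_single, permEv_single, LinearMap.smul_apply, LinearMap.smul_apply, ← h]
    rfl

theorem permEv_apply_one (ρ : C →* Equiv.Perm (L →ₐ[K] M)) (x : L →ₐ[K] M)
    (ξ : MonoidAlgebra M C) : permEv ρ x ξ 1 = IsForm.augHom K M C ξ := by
  induction ξ using MonoidAlgebra.induction_linear with
  | zero => simp
  | add ξ ξ' h h' => rw [map_add, map_add, LinearMap.add_apply, h, h']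
  | single c m => simp

/-- The linear extension of `(c, c') ↦ (ρ c x) l * (ρ c' x) l'`. -/
noncomputable def permEvTwo (ρ : C →* Equiv.Perm (L →ₐ[K] M)) (x : L →ₐ[K] M) (l l' : L) :
    MonoidAlgebra M (C × C) →ₗ[M] M :=
  Finsupp.linearCombination M (fun c : C × C => ρ c.1 x l * ρ c.2 x l') ∘ₗ
    (coeffLinearEquiv M : MonoidAlgebra M (C × C) ≃ₗ[M] C × C →₀ M).toLinearMap

@[simp] theorem permEvTwo_single (ρ : C →* Equiv.Perm (L →ₐ[K] M)) (x : L →ₐ[K] M) (l l' : L)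
    (c c' : C) (m : M) :
    permEvTwo ρ x l l' (single (c, c') m) = m * (ρ c x l * ρ c' x l') := by
  simp [permEvTwo]

theorem permEvTwo_inl_mul_inr (ρ : C →* Equiv.Perm (L →ₐ[K] M)) (x : L →ₐ[K] M) (l l' : L)
    (ξ η : MonoidAlgebra M C) :
    permEvTwo ρ x l l' (mapDomainAlgHom K M (MonoidHom.inl C C) ξ *
      mapDomainAlgHom K M (MonoidHom.inr C C) η) = permEv ρ x ξ l * permEv ρ x η l' := by
  induction ξ using MonoidAlgebra.induction_linear with
  | zero => simp
  | add ξ ξ' h h' => simp only [map_add, add_mul, LinearMap.add_apply, h, h']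
  | single c m =>
    induction η using MonoidAlgebra.induction_linear with
    | zero => simp
    | add η η' h h' => simp only [map_add, mul_add, LinearMap.add_apply, h, h']
    | single c' m' =>
      simp only [mapDomainAlgHom_single, single_mul_single, MonoidHom.inl_apply,
        MonoidHom.inr_apply, Prod.mk_mul_mk, mul_one, one_mul, permEvTwo_single, permEv_single,
        LinearMap.smul_apply, smul_eq_mul, AlgHom.toLinearMap_apply]
      ring

theorem permEvTwo_diag (ρ : C →* Equiv.Perm (L →ₐ[K] M)) (x : L →ₐ[K] M) (l l' : L)
    (ξ : MonoidAlgebra M C) :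
    permEvTwo ρ x l l' (mapDomainAlgHom K M (IsForm.diagHom C) ξ) = permEv ρ x ξ (l * l') := by
  induction ξ using MonoidAlgebra.induction_linear with
  | zero => simp
  | add ξ ξ' h h' => simp only [map_add, LinearMap.add_apply, h, h']
  | single c m =>
    rw [mapDomainAlgHom_single]
    simp [IsForm.diagHom]

variable [Algebra.IsSeparable K L] [IsNormalClosure K L M] [FiniteDimensional K L]

/-- Evaluation embeds `L` in the equivariant functions on the set of embeddings, and both have
dimension `[L : K]`. -/
theorem exists_apply_eq_of_equivariant {g : (L →ₐ[K] M) → M}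
    (hg : ∀ σ x, g (embPerm K L M σ x) = σ (g x)) : ∃ l : L, ∀ x, x l = g x := by
  have := finiteDimensional_of_isNormalClosure K L M
  have := isGalois_of_isNormalClosure K L M
  obtain ⟨x₀⟩ := nonempty_embeddings K L M
  let F : L →ₗ[K] equivariantFun (embPerm K L M) := LinearMap.codRestrict _
    (LinearMap.pi fun x : L →ₐ[K] M => x.toLinearMap) fun l σ x => rfl
  have hF : Function.Injective F := fun l l' h =>
    x₀.injective (congrFun (congrArg Subtype.val h) x₀)
  have hr : Module.finrank K L = Module.finrank K (equivariantFun (embPerm K L M)) := by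
    rw [finrank_equivariantFun, card_embeddings]
  obtain ⟨l, hl⟩ := (LinearMap.injective_iff_surjective_of_finrank_eq_finrank hr).mp hF
    ⟨g, hg⟩
  exact ⟨l, fun x => congrFun (congrArg Subtype.val hl) x⟩

variable [Finite C] {D : Type u} [CommRing D] [Algebra K D]

/-- The element `d` sends `l` to the element of `L` whose image under each `x` is `∑ (f d)_c (ρ c x)
l`; it exists because this expression is equivariant in `x`. The axioms are checked after applying
one embedding `x₀`. Bijectivity of the Galois map rests on the independence of embeddings, the
independence over `M` of the image of a basis of `D`, and a dimension count. -/
theorem exists_hopfGaloisStructure_of_isForm {ρ : C →* Equiv.Perm (L →ₐ[K] M)}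
    (hbij : ∀ x, Function.Bijective fun c => ρ c x)
    {θ : (M ≃ₐ[K] M) →* MulAut C}
    (hθ : ∀ σ c x, ρ (θ σ c) (embPerm K L M σ x) = embPerm K L M σ (ρ c x))
    {f : D →ₐ[K] MonoidAlgebra M C} (hf : IsForm θ f) :
    ∃ S : HopfGaloisStructure K L, S.IsOfType M C ∧ S.embSpace M = permSpace ρ := by
  have := finiteDimensional_of_isNormalClosure K L M
  have := isGalois_of_isNormalClosure K L M
  obtain ⟨x₀⟩ := nonempty_embeddings K L M
  have inj : Function.Injective x₀ := x₀.injective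
  have hfin := hf.finite
  have hequiv : ∀ (d : D) (l : L) σ x,
      permEv ρ (embPerm K L M σ x) (f d) l = σ (permEv ρ x (f d) l) := by
    intro d l σ x
    have := Fintype.ofFinite C
    simp only [permEv, LinearMap.comp_apply, Finsupp.linearCombination_apply,
      LinearEquiv.coe_coe]
    rw [Finsupp.sum_fintype _ _ (by simp), Finsupp.sum_fintype _ _ (by simp)]
    simp only [LinearMap.sum_apply, map_sum, LinearMap.smul_apply, smul_eq_mul, map_mul]
    refine (Fintype.sum_equiv (θ σ).toEquiv _ _ fun c => ?_).symm
    change σ ((f d).coeff c) * σ (ρ c x l) =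
      (f d).coeff (θ σ c) * (ρ (θ σ c) (embPerm K L M σ x)) l
    rw [hθ, hf.coeff_apply]
    rfl
  choose act hact using fun (d : D) (l : L) => exists_apply_eq_of_equivariant
    (g := fun x => permEv ρ x (f d) l) (hequiv d l)
  let μ : D →ₐ[K] Module.End K L :=
    { toFun := fun d =>
        { toFun := act d
          map_add' := fun l l' => inj (by simp [hact])
          map_smul' := fun k l => inj (by simp [hact]) }
      map_zero' := LinearMap.ext fun l => inj ((hact 0 l x₀).trans (by simp))
      map_one' := LinearMap.ext fun l => inj ((hact 1 l x₀).trans (by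
        rw [map_one, MonoidAlgebra.one_def]; simp))
      map_add' := fun d d' => LinearMap.ext fun l => inj ((hact _ l x₀).trans (by
        simp [hact]))
      map_mul' := fun d d' => LinearMap.ext fun l => inj ((hact _ l x₀).trans (by
        change _ = x₀ (act d (act d' l))
        rw [hact, permEv_apply_of_forall ρ (hact d' l), map_mul, mul_comm]))
      commutes' := fun k => LinearMap.ext fun l => inj ((hact _ l x₀).trans (by
        change _ = x₀ (k • l)
        rw [f.commutes, Algebra.algebraMap_eq_smul_one, ← algebraMap_smul M k, map_smul,
          MonoidAlgebra.one_def, permEv_single, map_smul, map_one, one_smul, LinearMap.smul_apply,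
          algebraMap_smul]
        rfl)) }
  have hμ : ∀ d l x, x (μ d l) = permEv ρ x (f d) l := hact
  let _ := hf.hopfAlgebra
  let S : HopfGaloisStructure K L :=
    { H := D
      hopf := hf.hopfAlgebra
      finite := hfin
      cocomm := hf.isCocomm
      μ := μ
      act_one := fun d => inj (by
        rw [hμ, permEv_apply_one, ← hf.algebraMap_counitHom]
        exact (x₀.commutes _).symm)
      act_mul := fun d l l' => inj (by
        have e : ∀ t : D ⊗[K] D, x₀ (LinearMap.mul' K L
            (TensorProduct.map (μ.toLinearMap.flip l) (μ.toLinearMap.flip l') t)) =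
            permEvTwo ρ x₀ l l' (formTensor f f t) := by
          intro t
          induction t with
          | zero => simp
          | add t t' h h' => simp only [map_add, h, h']
          | tmul d d' =>
            rw [formTensor_tmul, permEvTwo_inl_mul_inr, ← hμ, ← hμ]
            simp
        refine Eq.trans ?_ (e (hf.comulHom d)).symm
        rw [hf.formTensor_comulHom, permEvTwo_diag, hμ])
      galois := by
        obtain ⟨n, b, hb⟩ := hf.preservesIndep
        have hr : Module.finrank K (L ⊗[K] D) = Module.finrank K (Module.End K L) := by
          rw [Module.finrank_tensorProduct, Module.finrank_linearMap, hf.finrank_eq,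
            ← card_embeddings K L M, Nat.card_congr (Equiv.ofBijective _ (hbij x₀))]
        have hinj : Function.Injective (TensorProduct.lift
            ((LinearMap.mul K (Module.End K L)).compl₁₂
              (Algebra.lmul K L).toLinearMap μ.toLinearMap)) := by
          rw [injective_iff_map_eq_zero]
          intro t ht
          obtain ⟨a, rfl⟩ := TensorProduct.eq_repr_basis_right b t
          have h1 : ∑ i, x₀ (a i) • f (b i) = 0 := by
            apply permEv_injective x₀ (hbij x₀).1
            ext l
            have h2 := congrArg x₀ (LinearMap.congr_fun ht l)
            simp only [map_sum, map_smul, LinearMap.sum_apply, LinearMap.smul_apply, ← hμ]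
            simpa [Finsupp.sum_fintype] using h2
          have h2 := Fintype.linearIndependent_iff.mp hb _ h1
          have ha : a = 0 := by
            ext i
            exact inj ((h2 i).trans (map_zero x₀).symm)
          simp [ha]
        exact ⟨hinj, (LinearMap.injective_iff_surjective_of_finrank_eq_finrank hr).mp hinj⟩ }
  refine ⟨S, ⟨hf.baseChangeEquiv⟩, ?_⟩
  have hev : ∀ x (t : M ⊗[K] D), S.evTensor x t = permEv ρ x (IsForm.baseChangeHom f t) := by
    intro x t
    induction t with
    | zero => simp
    | add t t' h h' => simp only [map_add, h, h']
    | tmul m d =>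
      rw [IsForm.baseChangeHom_tmul, map_smul]
      ext l
      refine (S.evTensor_tmul x m d l).trans ?_
      rw [LinearMap.smul_apply, smul_eq_mul, ← hμ]
  apply le_antisymm
  · rintro _ ⟨t, rfl⟩
    exact ⟨IsForm.baseChangeHom f t, funext fun x => (hev x t).symm⟩
  · rintro _ ⟨ξ, rfl⟩
    obtain ⟨t, rfl⟩ := hf.baseChangeHom_bijective.2 ξ
    exact ⟨t, funext fun x => hev x t⟩

end Construction

/-! ### The Greither-Pareigis correspondence for abelian types. -/

section Correspondence

variable {K : Type u} {L : Type v} {M : Type w} [Field K] [Field L] [Field M]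
  [Algebra K L] [Algebra K M] {C : Type*} [CommGroup C] [Finite C]
  [Algebra.IsSeparable K L] [IsNormalClosure K L M] [FiniteDimensional K L]

theorem IsRegNormalized.exists_hopfGaloisStructure {ρ : C →* Equiv.Perm (L →ₐ[K] M)}
    (hρ : IsRegNormalized (embPerm K L M) ρ) :
    ∃ S : HopfGaloisStructure K L, S.IsOfType M C ∧ S.embSpace M = permSpace ρ := by
  have := finiteDimensional_of_isNormalClosure K L M
  have := isGalois_of_isNormalClosure K L M
  have hne := nonempty_embeddings K L M
  obtain ⟨θ, hθ⟩ := hρ.exists_conj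
  have hval : IsForm θ (fixedSubalgebra θ).val :=
    ⟨Subtype.val_injective, Subalgebra.range_val _⟩
  have hfin := hval.finite
  -- A Hopf Galois structure keeps `H` in the universe of `K`; the fixed algebra, finite over `K`,
  -- has a copy there.
  have hsmall : Small.{u} (fixedSubalgebra θ) :=
    ⟨_, ⟨(Module.finBasis K (fixedSubalgebra θ)).equivFun.toEquiv⟩⟩
  let e : Shrink.{u} (fixedSubalgebra θ) ≃ₐ[K] fixedSubalgebra θ := Shrink.algEquiv K _
  have hf : IsForm θ ((fixedSubalgebra θ).val.comp e.toAlgHom) := by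
    refine ⟨Subtype.val_injective.comp e.injective, ?_⟩
    refine Eq.trans ?_ hval.range_eq
    ext ξ
    constructor
    · rintro ⟨d, rfl⟩
      exact ⟨e d, rfl⟩
    · rintro ⟨d, rfl⟩
      exact ⟨e.symm d, congrArg Subtype.val (e.apply_symm_apply d)⟩
  exact exists_hopfGaloisStructure_of_isForm hρ.bijective
    (fun σ c x => IsRegNormalized.apply_comm hθ σ c x) hf

/-- The subgroups of `Perm X` attached to regular representations of `C` normalised by `a`. -/
def regNormalizedSubgroups {G X : Type*} [Group G] (a : G →* Equiv.Perm X) (C : Type*)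
    [CommGroup C] : Set (Subgroup (Equiv.Perm X)) :=
  {N | ∃ ρ : C →* Equiv.Perm X, IsRegNormalized a ρ ∧ ρ.range = N}

variable (K L M C)

theorem exists_isOfType_iff (hC : Nat.card C = Module.finrank K L) :
    (∃ S : HopfGaloisStructure K L, S.IsOfType M C) ↔
      ∃ ρ : C →* Equiv.Perm (L →ₐ[K] M), IsRegNormalized (embPerm K L M) ρ := by
  constructor
  · rintro ⟨S, hS⟩
    obtain ⟨ρ, hρ, -⟩ := S.exists_isRegNormalized hC hS
    exact ⟨ρ, hρ⟩
  · rintro ⟨ρ, hρ⟩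
    obtain ⟨S, hS, -⟩ := hρ.exists_hopfGaloisStructure
    exact ⟨S, hS⟩

/-- Isomorphism classes and regular subgroups both inject into the subspaces of families of linear
maps, and the two constructions show that the images coincide. -/
theorem ncard_classesOfType (hC : Nat.card C = Module.finrank K L) :
    (HopfGaloisStructure.classesOfType K L M C).ncard =
      (regNormalizedSubgroups (embPerm K L M) C).ncard := by
  have hne := nonempty_embeddings K L M
  let F : Quotient (HopfGaloisStructure.isoSetoid K L) →
      Submodule M ((L →ₐ[K] M) → (L →ₗ[K] M)) :=
    Quotient.lift (fun S => S.embSpace M) fun S T h =>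
      (HopfGaloisStructure.iso_iff_embSpace_eq S T).mp h
  have hF : Function.Injective F := by
    intro q r
    induction q using Quotient.inductionOn
    induction r using Quotient.inductionOn
    intro h
    exact Quotient.sound ((HopfGaloisStructure.iso_iff_embSpace_eq _ _).mpr h)
  let E : Subgroup (Equiv.Perm (L →ₐ[K] M)) → Submodule M ((L →ₐ[K] M) → (L →ₗ[K] M)) :=
    fun N => Submodule.span M ((fun (π : Equiv.Perm (L →ₐ[K] M)) x => (π x).toLinearMap) ''
      (N : Set (Equiv.Perm (L →ₐ[K] M))))
  have hE : ∀ ρ : C →* Equiv.Perm (L →ₐ[K] M), E ρ.range = permSpace ρ := fun ρ =>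
    (permSpace_eq_span ρ).symm
  have hEinj : Set.InjOn E (regNormalizedSubgroups (embPerm K L M) C) := by
    rintro _ ⟨ρ, hρ, rfl⟩ _ ⟨ρ', hρ', rfl⟩ h
    rw [hE, hE] at h
    exact (permSpace_eq_iff hρ.bijective hρ'.bijective).mp h
  rw [← Set.ncard_image_of_injective _ hF, ← hEinj.ncard_image]
  congr 1
  ext V
  constructor
  · rintro ⟨_, ⟨S, hS, rfl⟩, rfl⟩
    obtain ⟨ρ, hρ, h⟩ := S.exists_isRegNormalized hC hS
    exact ⟨ρ.range, ⟨ρ, hρ, rfl⟩, (hE ρ).trans h.symm⟩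
  · rintro ⟨_, ⟨ρ, hρ, rfl⟩, rfl⟩
    obtain ⟨S, hS, h⟩ := hρ.exists_hopfGaloisStructure
    exact ⟨_, ⟨S, hS, rfl⟩, h.trans (hE ρ).symm⟩

end Correspondence

/-! ### Cyclic groups of order `2p` and cyclic semidirect products -/

section CyclicAut

variable {C : Type*} [CommGroup C] [Finite C] [IsCyclic C]

/-- An automorphism of a cyclic group is a power map, and an even exponent would kill an element of
order two. -/
theorem MulAut.exists_odd_zpow_of_even_card (hC : Even (Nat.card C)) (α : MulAut C) :
    ∃ k : ℤ, Odd k ∧ ∀ c, α c = c ^ k := by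
  obtain ⟨k, hk⟩ := MonoidHom.map_cyclic α.toMonoidHom
  obtain ⟨z, hz⟩ := exists_prime_orderOf_dvd_card' 2 hC.two_dvd
  refine ⟨k, ?_, hk⟩
  rw [← Int.not_even_iff_odd]
  intro hk2
  have h1 : α z = 1 := by
    have : α z = z ^ k := hk z
    rw [this, ← orderOf_dvd_iff_zpow_eq_one, hz]
    exact_mod_cast hk2.two_dvd
  rw [α.map_eq_one_iff] at h1
  simp [h1] at hz

theorem MulAut.apply_eq_self_of_sq_eq_one (hC : Even (Nat.card C)) (α : MulAut C) {c : C}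
    (hc : c ^ 2 = 1) : α c = c := by
  obtain ⟨k, ⟨l, rfl⟩, hk⟩ := α.exists_odd_zpow_of_even_card hC
  rw [hk, zpow_add, zpow_mul]
  norm_cast
  simp [hc]

/-- With `α` the `k`-th power map, `k - 1` is even, and it is divisible by `p` because `p` divides
the order of `c`. So `2 * p` divides `k - 1`. -/
theorem MulAut.eq_one_of_apply_eq_self {p : ℕ} (hp : p.Prime) (hp2 : p ≠ 2)
    (hC : Nat.card C = 2 * p) (α : MulAut C) {c : C} (hc : c ^ 2 ≠ 1) (h : α c = c) : α = 1 := by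
  obtain ⟨k, hk2, hk⟩ := α.exists_odd_zpow_of_even_card (by simp [hC])
  have h1 : (orderOf c : ℤ) ∣ k - 1 := by
    rw [orderOf_dvd_iff_zpow_eq_one, zpow_sub_one, ← hk, h, mul_inv_cancel]
  have h2 : p ∣ orderOf c := by
    have hd : orderOf c ∣ 2 * p := hC ▸ orderOf_dvd_natCard c
    by_contra hpc
    have := Nat.Coprime.dvd_of_dvd_mul_right ((Nat.Prime.coprime_iff_not_dvd hp).2 hpc).symm hd
    exact hc (orderOf_dvd_iff_pow_eq_one.1 this)
  have h3 : ((2 * p : ℕ) : ℤ) ∣ k - 1 := by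
    push_cast
    refine IsCoprime.mul_dvd ?_ (hk2.sub_odd odd_one).two_dvd ((Int.natCast_dvd_natCast.2 h2).trans h1)
    exact Nat.isCoprime_iff_coprime.2 ((Nat.coprime_primes Nat.prime_two hp).2 hp2.symm)
  ext d
  have h4 : d ^ (k - 1) = 1 := by
    rw [← orderOf_dvd_iff_zpow_eq_one]
    exact (Int.natCast_dvd_natCast.2 (hC ▸ orderOf_dvd_natCard d)).trans h3
  rw [hk, MulAut.one_apply]
  rwa [zpow_sub_one, mul_inv_eq_one] at h4

theorem IsCyclic.eq_of_sq_eq_one {c d : C} (hc : c ^ 2 = 1) (hc1 : c ≠ 1) (hd : d ^ 2 = 1)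
    (hd1 : d ≠ 1) : c = d := by
  classical
  have := Fintype.ofFinite C
  by_contra hcd
  have h3 := IsCyclic.card_pow_eq_one_le (α := C) (n := 2) two_pos
  have hsub : ({1, c, d} : Finset C) ⊆ Finset.univ.filter fun a : C => a ^ 2 = 1 := by
    intro x hx
    simp only [Finset.mem_insert, Finset.mem_singleton] at hx
    rcases hx with rfl | rfl | rfl <;> simp [*]
  have := (Finset.card_le_card hsub).trans h3
  rw [Finset.card_eq_three.2 ⟨1, c, d, hc1.symm, hd1.symm, hcd, rfl⟩] at this
  omega

theorem MulAut.natCard_of_isCyclic {p : ℕ} (hp : p.Prime) (hp2 : p ≠ 2)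
    (hC : Nat.card C = 2 * p) : Nat.card (MulAut C) = p - 1 := by
  rw [IsCyclic.card_mulAut, hC, Nat.totient_mul ((Nat.coprime_primes Nat.prime_two hp).2 hp2.symm),
    Nat.totient_two, one_mul, Nat.totient_prime hp]

theorem MulAut.isCyclic_of_card_eq_two_mul_prime {p : ℕ} (hp : p.Prime) (hp2 : p ≠ 2)
    (hC : Nat.card C = 2 * p) : IsCyclic (MulAut C) := by
  have : IsCyclic (ZMod (Nat.card C))ˣ := by
    rw [hC, ZMod.isCyclic_units_iff]
    exact Or.inr <| Or.inr <| Or.inr <| Or.inr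
      ⟨p, 1, hp, hp.odd_of_ne_two hp2, le_rfl, Or.inr (by rw [pow_one])⟩
  exact isCyclic_of_injective (IsCyclic.mulAutMulEquiv C).toMonoidHom
    (IsCyclic.mulAutMulEquiv C).injective

end CyclicAut

@[simp] theorem natCard_cyc (n : ℕ) : Nat.card (Cyc n) = n :=
  (Nat.card_congr Multiplicative.toAdd).trans (Nat.card_zmod n)

theorem IsCyclicSemidirect.of_isComplement' {G : Type*} [Group G] {N Q : Subgroup G} [N.Normal]
    [IsCyclic N] [IsCyclic Q] (h : N.IsComplement' Q)
    (hQ : ∀ q ∈ Q, (∀ n ∈ N, q * n * q⁻¹ = n) → q = 1) :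
    IsCyclicSemidirect G (Nat.card N) (Nat.card Q) := by
  let e₁ : N ≃* Cyc (Nat.card N) := mulEquivOfCyclicCardEq (by simp)
  let e₂ : Q ≃* Cyc (Nat.card Q) := mulEquivOfCyclicCardEq (by simp)
  refine ⟨_, ?_, ⟨(SemidirectProduct.mulEquivSubgroup h).symm.trans
    (SemidirectProduct.congr' (fn := e₁) (fg := e₂))⟩⟩
  rw [MonoidHom.coe_comp, MonoidHom.coe_comp]
  refine (MulAut.congr e₁).injective.comp (Function.Injective.comp ?_ e₂.symm.injective)
  rw [injective_iff_map_eq_one]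
  intro q hq
  refine Subtype.ext (hQ q q.2 fun n hn => ?_)
  have := congrArg (fun α : MulAut N => (α ⟨n, hn⟩ : G)) hq
  exact this

theorem IsCyclicSemidirect.natCard_eq {G : Type*} [Group G] {n m : ℕ}
    (h : IsCyclicSemidirect G n m) : Nat.card G = n * m := by
  obtain ⟨φ, -, ⟨e⟩⟩ := h
  rw [Nat.card_congr e.toEquiv, SemidirectProduct.card]
  simp

/-- The homomorphism from a dihedral group determined by the images of the rotations and of a
reflection. -/
def DihedralGroup.liftCyc {n : ℕ} {G : Type*} [Group G] (f : Cyc n →* G) (s : G) (hs : s * s = 1)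
    (hsf : ∀ c, f c * s = s * f c⁻¹) : DihedralGroup n →* G :=
  MonoidHom.mk' (fun x => match x with
    | .r i => f (Multiplicative.ofAdd i)
    | .sr i => s * f (Multiplicative.ofAdd i)) (by
    rintro (i | i) (j | j)
    · rw [DihedralGroup.r_mul_r]
      simp [ofAdd_add]
    · rw [DihedralGroup.r_mul_sr]
      simp only
      rw [← mul_assoc, hsf, mul_assoc, ← map_mul, sub_eq_neg_add]
      rfl
    · rw [DihedralGroup.sr_mul_r]
      simp [ofAdd_add, mul_assoc]
    · rw [DihedralGroup.sr_mul_sr]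
      simp only
      rw [← mul_assoc, mul_assoc s, hsf, ← mul_assoc, hs, one_mul, ← map_mul, sub_eq_neg_add]
      rfl)

/-- The involution acts as a power map with exponent `k` and `p ∣ (k + 1) * (k - 1)`. Faithfulness
excludes `p ∣ k - 1`, so it acts by inversion. -/
theorem IsCyclicSemidirect.nonempty_mulEquiv_dihedralGroup {G : Type*} [Group G] {p : ℕ}
    (hp : p.Prime) (h : IsCyclicSemidirect G p 2) : Nonempty (G ≃* DihedralGroup p) := by
  obtain ⟨φ, hφ, ⟨e⟩⟩ := h
  have : NeZero p := ⟨hp.ne_zero⟩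
  obtain ⟨s, hs, hs1⟩ : ∃ s : Cyc 2, s * s = 1 ∧ s ≠ 1 :=
    ⟨Multiplicative.ofAdd 1, by decide, by decide⟩
  have hp' : Nat.card (Cyc p) = p := natCard_cyc p
  have hinv : ∀ c, φ s c = c⁻¹ := by
    obtain ⟨k, hk⟩ := MonoidHom.map_cyclic (φ s).toMonoidHom
    replace hk : ∀ c, φ s c = c ^ k := hk
    obtain ⟨g, hg⟩ := IsCyclic.exists_ofOrder_eq_natCard (α := Cyc p)
    rw [hp'] at hg
    have h1 : (p : ℤ) ∣ (k + 1) * (k - 1) := by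
      rw [← hg, orderOf_dvd_iff_zpow_eq_one]
      have : φ (s * s) g = g := by rw [hs, map_one, MulAut.one_apply]
      rw [map_mul, MulAut.mul_apply, hk, hk, ← zpow_mul] at this
      rw [show (k + 1) * (k - 1) = k * k - 1 by ring, zpow_sub_one, this, mul_inv_cancel]
    have hpow : ∀ l : ℤ, (p : ℤ) ∣ l → ∀ c : Cyc p, c ^ l = 1 := fun l hl c => by
      rw [← orderOf_dvd_iff_zpow_eq_one]
      refine (Int.natCast_dvd_natCast.2 ?_).trans hl
      have := orderOf_dvd_natCard c
      rwa [hp'] at this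
    rcases (Nat.prime_iff_prime_int.1 hp).dvd_or_dvd h1 with h | h
    · intro c
      rw [hk, eq_inv_iff_mul_eq_one, ← zpow_add_one]
      exact hpow _ h c
    · refine absurd (hφ (?_ : φ s = φ 1)) hs1
      ext c : 1
      rw [map_one, MulAut.one_apply, hk, ← mul_inv_eq_one, ← zpow_sub_one]
      exact hpow _ h c
  let F : DihedralGroup p →* Cyc p ⋊[φ] Cyc 2 :=
    DihedralGroup.liftCyc SemidirectProduct.inl (SemidirectProduct.inr s)
      (by rw [← map_mul, hs, map_one]) (fun c => by
        rw [← hinv, SemidirectProduct.inl_aut, ← eq_inv_of_mul_eq_one_left hs, ← mul_assoc,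
          ← mul_assoc, ← map_mul, hs, map_one, one_mul])
  have hF : Function.Injective F := by
    rw [injective_iff_map_eq_one]
    rintro (i | i) hi
    · have : SemidirectProduct.inl (φ := φ) (Multiplicative.ofAdd i) = 1 := hi
      rw [← map_one SemidirectProduct.inl, SemidirectProduct.inl_inj] at this
      rw [DihedralGroup.one_def]
      exact congrArg DihedralGroup.r this
    · exfalso
      have : SemidirectProduct.inr (φ := φ) s * SemidirectProduct.inl (Multiplicative.ofAdd i) = 1 :=
        hi
      apply hs1
      simpa using congrArg SemidirectProduct.rightHom this
  have hcard : Nat.card (DihedralGroup p) = Nat.card (Cyc p ⋊[φ] Cyc 2) := by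
    rw [DihedralGroup.nat_card, SemidirectProduct.card]
    simp [mul_comm]
  have : Finite (Cyc p ⋊[φ] Cyc 2) := Nat.finite_of_card_ne_zero (by
    rw [← hcard, DihedralGroup.nat_card]; exact mul_ne_zero two_ne_zero hp.ne_zero)
  exact ⟨e.trans (MulEquiv.ofBijective F
    ((Nat.bijective_iff_injective_and_card F).2 ⟨hF, hcard⟩)).symm⟩

/-! ### Groups normalising a regular cyclic group of degree `2p` -/

theorem index_comap_stabilizer {G X : Type*} [Group G] {a : G →* Equiv.Perm X}
    (ht : ∀ x y, ∃ σ, a σ x = y) (x : X) :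
    ((MulAction.stabilizer (Equiv.Perm X) x).comap a).index = Nat.card X := by
  let _ : MulAction G X := MulAction.compHom X a
  have : MulAction.IsPretransitive G X := ⟨ht⟩
  exact MulAction.index_stabilizer_of_transitive G x

namespace IsRegNormalized

variable {G X C : Type*} [Group G] [CommGroup C] {a : G →* Equiv.Perm X} {ρ : C →* Equiv.Perm X}
  {θ : G →* MulAut C}

theorem natCard_eq [Nonempty X] (h : IsRegNormalized a ρ) : Nat.card C = Nat.card X :=
  Nat.card_congr (Equiv.ofBijective _ (h.bijective (Classical.arbitrary X)))

/-- A regular abelian group of permutations is its own centraliser. -/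
theorem exists_eq_of_commute [Nonempty X] (h : IsRegNormalized a ρ) {π : Equiv.Perm X}
    (hπ : ∀ c, π * ρ c = ρ c * π) : ∃ c, π = ρ c := by
  let x₀ := Classical.arbitrary X
  obtain ⟨c, hc⟩ := (h.bijective x₀).2 (π x₀)
  refine ⟨c, Equiv.ext fun y => ?_⟩
  obtain ⟨d, rfl⟩ := (h.bijective x₀).2 y
  have h1 := congrArg (fun π : Equiv.Perm X => π x₀) (hπ d)
  simp only [Equiv.Perm.mul_apply] at h1 hc ⊢
  rw [h1, ← hc, ← Equiv.Perm.mul_apply, ← Equiv.Perm.mul_apply, ← map_mul, ← map_mul, mul_comm]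

theorem exists_eq_of_mem_ker [Nonempty X] (h : IsRegNormalized a ρ)
    (hθ : ∀ σ c, ρ (θ σ c) = a σ * ρ c * (a σ)⁻¹) {σ : G} (hσ : σ ∈ θ.ker) : ∃ c, a σ = ρ c := by
  refine h.exists_eq_of_commute fun c => ?_
  have := hθ σ c
  rw [MonoidHom.mem_ker.1 hσ, MulAut.one_apply, eq_mul_inv_iff_mul_eq] at this
  exact this.symm

variable [Finite C] [IsCyclic C]

theorem isCyclic_ker [Nonempty X] (h : IsRegNormalized a ρ) (ha : Function.Injective a)
    (hθ : ∀ σ c, ρ (θ σ c) = a σ * ρ c * (a σ)⁻¹) : IsCyclic θ.ker := by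
  have : IsCyclic ρ.range := isCyclic_of_surjective ρ.rangeRestrict ρ.rangeRestrict_surjective
  refine isCyclic_of_injective ((a.comp θ.ker.subtype).codRestrict ρ.range fun σ => ?_) ?_
  · obtain ⟨c, hc⟩ := h.exists_eq_of_mem_ker hθ σ.2
    exact ⟨c, hc.symm⟩
  · intro σ τ hστ
    exact Subtype.ext (ha (congrArg Subtype.val hστ))

theorem natCard_ker_dvd [Nonempty X] (h : IsRegNormalized a ρ) (ha : Function.Injective a)
    (hθ : ∀ σ c, ρ (θ σ c) = a σ * ρ c * (a σ)⁻¹) : Nat.card θ.ker ∣ Nat.card C := by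
  have : Finite ρ.range := Finite.of_surjective _ ρ.rangeRestrict_surjective
  have h1 : θ.ker.map a ≤ ρ.range := by
    rintro _ ⟨σ, hσ, rfl⟩
    obtain ⟨c, hc⟩ := h.exists_eq_of_mem_ker hθ hσ
    exact ⟨c, hc.symm⟩
  have h2 := Subgroup.card_dvd_of_le h1
  rw [Nat.card_congr (Subgroup.equivMapOfInjective θ.ker a ha).toEquiv]
  refine h2.trans (Subgroup.card_range_dvd ρ)

variable [Finite G] {p : ℕ}

/-- By transitivity `2 * p` divides `|G| = |ker θ| |im θ|`. As `|im θ|` divides `p - 1`, the factor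
`p` must divide `|ker θ|`, which in turn divides `|C| = 2 * p`. -/
theorem natCard_ker [Nonempty X] (h : IsRegNormalized a ρ) (ha : Function.Injective a)
    (ht : ∀ x y, ∃ σ, a σ x = y) (hθ : ∀ σ c, ρ (θ σ c) = a σ * ρ c * (a σ)⁻¹)
    (hp : p.Prime) (hp2 : p ≠ 2) (hC : Nat.card C = 2 * p) :
    Nat.card θ.ker = p ∨ Nat.card θ.ker = 2 * p := by
  have h1 := h.natCard_ker_dvd ha hθ
  rw [hC] at h1
  have hG : 2 * p ∣ Nat.card θ.ker * Nat.card θ.range := by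
    rw [← Subgroup.index_ker, Subgroup.card_mul_index, ← hC, h.natCard_eq,
      ← index_comap_stabilizer ht (Classical.arbitrary X)]
    exact Subgroup.index_dvd_card _
  have h3 : Nat.card θ.range ∣ p - 1 := by
    rw [← MulAut.natCard_of_isCyclic hp hp2 hC]
    exact Subgroup.card_subgroup_dvd_card _
  have h4 : p ∣ Nat.card θ.ker := by
    refine (hp.dvd_mul.1 ((dvd_mul_left p 2).trans hG)).resolve_right fun h5 => ?_
    have := Nat.le_of_dvd (by have := hp.two_le; omega) (h5.trans h3)
    have := hp.two_le
    omega
  obtain ⟨k, hk⟩ := h4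
  rw [hk, mul_comm] at h1
  have : k ∣ 2 := Nat.dvd_of_mul_dvd_mul_right hp.pos h1
  rcases (Nat.dvd_prime Nat.prime_two).1 this with rfl | rfl
  · left; omega
  · right; rw [hk, mul_comm]

/-- A complement to the centraliser of `C` is cyclic of order dividing `p - 1`, and `G` is a
semidirect product. -/
theorem isCyclicSemidirect_of_isComplement' [Nonempty X] (h : IsRegNormalized a ρ)
    (ha : Function.Injective a)
    (ht : ∀ x y, ∃ σ, a σ x = y) (hθ : ∀ σ c, ρ (θ σ c) = a σ * ρ c * (a σ)⁻¹)
    (hp : p.Prime) (hp2 : p ≠ 2) (hC : Nat.card C = 2 * p) {Q : Subgroup G}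
    (hQ : θ.ker.IsComplement' Q) :
    Nat.card Q ∣ p - 1 ∧ IsCyclicSemidirect G (Nat.card θ.ker) (Nat.card Q) := by
  have := MulAut.isCyclic_of_card_eq_two_mul_prime hp hp2 hC
  have hinj : Function.Injective (θ.comp Q.subtype) := by
    rw [injective_iff_map_eq_one]
    intro q hq
    have hq' : (q : G) ∈ θ.ker := hq
    exact Subtype.ext (Subgroup.disjoint_def.1 hQ.disjoint hq' q.2)
  have hQc : IsCyclic Q := isCyclic_of_injective _ hinj
  have := h.isCyclic_ker ha hθ
  refine ⟨?_, .of_isComplement' hQ fun q hq hqc => ?_⟩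
  · rw [← MulAut.natCard_of_isCyclic hp hp2 hC]
    exact Subgroup.card_dvd_of_injective _ hinj
  -- Faithfulness: `q` centralises an element of order `p` in the kernel, which lies in `C`, so `θ
  -- q` fixes an element whose square is not `1` and is trivial.
  · have h1 : p ∣ Nat.card θ.ker := by
      rcases h.natCard_ker ha ht hθ hp hp2 hC with h1 | h1
      · exact h1 ▸ dvd_rfl
      · exact h1 ▸ dvd_mul_left p 2
    have := Fact.mk hp
    obtain ⟨g, hg⟩ := exists_prime_orderOf_dvd_card' p h1
    obtain ⟨c, hc⟩ := h.exists_eq_of_mem_ker hθ g.2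
    have hc2 : c ^ 2 ≠ 1 := by
      intro h2
      have h3 : g ^ 2 = 1 := by
        apply Subtype.ext
        apply ha
        rw [Subgroup.coe_pow, map_pow, hc, ← map_pow, h2]
        simp
      rw [← orderOf_dvd_iff_pow_eq_one, hg, Nat.prime_dvd_prime_iff_eq hp Nat.prime_two] at h3
      exact hp2 h3
    have h4 : θ q c = c := by
      apply h.injective
      rw [hθ, ← hc, ← map_mul, ← map_inv, ← map_mul, hqc _ g.2]
    have h5 : q ∈ θ.ker := (θ q).eq_one_of_apply_eq_self hp hp2 hC hc2 h4
    exact Subgroup.disjoint_def.1 hQ.disjoint h5 hq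

/-- If the kernel has order `p`, its index is prime to `p` and Schur-Zassenhaus gives a complement,
of even order since `2 * p` divides `|G|`. If it has order `2 * p`, it acts freely and a point
stabiliser is a complement. -/
theorem isCyclicSemidirect [Nonempty X] (h : IsRegNormalized a ρ) (ha : Function.Injective a)
    (ht : ∀ x y, ∃ σ, a σ x = y)
    (hp : p.Prime) (hp2 : p ≠ 2) (hC : Nat.card C = 2 * p) :
    (∃ m : ℕ, m ∣ p - 1 ∧ IsCyclicSemidirect G (2 * p) m) ∨
      (∃ m : ℕ, Even m ∧ m ∣ p - 1 ∧ IsCyclicSemidirect G p m) := by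
  obtain ⟨θ, hθ⟩ := h.exists_conj
  have hst := fun x => index_comap_stabilizer ht x
  have hX : Nat.card X = 2 * p := by rw [← h.natCard_eq, hC]
  rcases h.natCard_ker ha ht hθ hp hp2 hC with hk | hk
  · right
    have h3 : Nat.card θ.range ∣ p - 1 := by
      rw [← MulAut.natCard_of_isCyclic hp hp2 hC]
      exact Subgroup.card_subgroup_dvd_card _
    obtain ⟨Q, hQ⟩ := Subgroup.exists_right_complement'_of_coprime (N := θ.ker) (by
      rw [hk, Subgroup.index_ker, Nat.Prime.coprime_iff_not_dvd hp]
      intro h5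
      have := Nat.le_of_dvd (by have := hp.two_le; omega) (h5.trans h3)
      have := hp.two_le
      omega)
    obtain ⟨h1, h2⟩ := h.isCyclicSemidirect_of_isComplement' ha ht hθ hp hp2 hC hQ
    rw [hk] at h2
    refine ⟨_, ?_, h1, h2⟩
    have h4 : 2 * p ∣ Nat.card G := by
      rw [← hX, ← hst (Classical.arbitrary X)]
      exact Subgroup.index_dvd_card _
    rw [h2.natCard_eq, mul_comm p] at h4
    exact even_iff_two_dvd.2 (Nat.dvd_of_mul_dvd_mul_right hp.pos h4)
  · left
    let x := Classical.arbitrary X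
    have hQ : θ.ker.IsComplement' ((MulAction.stabilizer (Equiv.Perm X) x).comap a) := by
      apply Subgroup.isComplement'_of_card_mul_and_disjoint
      · rw [hk, ← hX, ← hst x, mul_comm, Subgroup.card_mul_index]
      · rw [Subgroup.disjoint_def]
        intro σ hσ hσx
        obtain ⟨c, hc⟩ := h.exists_eq_of_mem_ker hθ hσ
        have h1 : a σ x = x := hσx
        have h2 : c = 1 := (h.bijective x).1 (by simp only [map_one, Equiv.Perm.one_apply, ← hc, h1])
        apply ha
        rw [hc, h2, map_one, map_one]
    obtain ⟨h1, h2⟩ := h.isCyclicSemidirect_of_isComplement' ha ht hθ hp hp2 hC hQ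
    rw [hk] at h2
    exact ⟨_, h1, h2⟩

end IsRegNormalized

/-! ### Construction of normalised regular cyclic groups -/

section Construction

variable {G X C : Type*} [Group G] [CommGroup C] {a : G →* Equiv.Perm X}

/-- Every conjugate of `n` is a power of `n`, because automorphisms of a cyclic group are power
maps. So `n` fixes all points once it fixes one. -/
theorem eq_one_of_mem_normal_of_apply_eq (ha : Function.Injective a) (ht : ∀ x y, ∃ σ, a σ x = y)
    {N : Subgroup G} [N.Normal] [IsCyclic N] {n : G} (hn : n ∈ N) {x : X} (hx : a n x = x) :
    n = 1 := by
  apply ha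
  rw [map_one]
  ext y
  obtain ⟨σ, rfl⟩ := ht x y
  obtain ⟨k, hk⟩ := MonoidHom.map_cyclic (MulAut.conjNormal (H := N) σ⁻¹).toMonoidHom
  have h1 : σ⁻¹ * n * σ = n ^ k := by
    simpa using congrArg Subtype.val (hk ⟨n, hn⟩)
  have h2 : a (n ^ k) x = x := by
    rw [map_zpow]
    have : a n ∈ MulAction.stabilizer (Equiv.Perm X) x := hx
    exact Subgroup.zpow_mem _ this k
  rw [← Equiv.Perm.mul_apply, ← map_mul, show n * σ = σ * (σ⁻¹ * n * σ) by group, h1, map_mul,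
    Equiv.Perm.mul_apply, h2, Equiv.Perm.one_apply]

theorem exists_isRegNormalized_of_subgroup [Finite X] [IsCyclic C] {P : Subgroup (Equiv.Perm X)}
    [IsCyclic P] (hPC : Nat.card P = Nat.card C) (hPX : Nat.card P = Nat.card X)
    (hfree : ∀ π ∈ P, ∀ x, π x = x → π = 1) (hnorm : ∀ σ, ∀ π ∈ P, a σ * π * (a σ)⁻¹ ∈ P) :
    ∃ ρ : C →* Equiv.Perm X, IsRegNormalized a ρ ∧ ρ.range = P := by
  let e : C ≃* P := mulEquivOfCyclicCardEq hPC.symm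
  refine ⟨P.subtype.comp e.toMonoidHom, ⟨fun x => ?_, fun σ c => ?_⟩, ?_⟩
  · rw [Nat.bijective_iff_injective_and_card]
    refine ⟨fun c d hcd => ?_, hPC.symm.trans hPX⟩
    have h1 : (e (d⁻¹ * c) : Equiv.Perm X) x = x := by
      have h2 : (e c : Equiv.Perm X) x = (e d : Equiv.Perm X) x := hcd
      rw [map_mul, map_inv, Subgroup.coe_mul, Equiv.Perm.mul_apply, h2, ← Equiv.Perm.mul_apply,
        Subgroup.coe_inv, inv_mul_cancel, Equiv.Perm.one_apply]
    have h2 : e (d⁻¹ * c) = 1 := Subtype.ext (hfree _ (e _).2 x h1)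
    rw [EmbeddingLike.map_eq_one_iff, inv_mul_eq_one] at h2
    exact h2.symm
  · refine ⟨e.symm ⟨_, hnorm σ _ (e c).2⟩, ?_⟩
    simp
  · ext π
    constructor
    · rintro ⟨c, rfl⟩
      exact (e c).2
    · intro hπ
      exact ⟨e.symm ⟨π, hπ⟩, by simp⟩

theorem exists_isRegNormalized_of_normal [Finite X] [IsCyclic C] (ha : Function.Injective a)
    (ht : ∀ x y, ∃ σ, a σ x = y) {N : Subgroup G} [N.Normal] [IsCyclic N]
    (hNC : Nat.card N = Nat.card C) (hNX : Nat.card N = Nat.card X) :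
    ∃ ρ : C →* Equiv.Perm X, IsRegNormalized a ρ := by
  have e := Subgroup.equivMapOfInjective N a ha
  have : IsCyclic (N.map a) := isCyclic_of_surjective e.toMonoidHom e.surjective
  have hc := (Nat.card_congr e.toEquiv).symm
  obtain ⟨ρ, hρ, -⟩ := exists_isRegNormalized_of_subgroup (a := a) (C := C) (P := N.map a)
    (hc.trans hNC) (hc.trans hNX) (by
      rintro _ ⟨n, hn, rfl⟩ x hx
      rw [eq_one_of_mem_normal_of_apply_eq ha ht hn hx, map_one]) (by
      rintro σ _ ⟨n, hn, rfl⟩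
      exact ⟨σ * n * σ⁻¹, Subgroup.Normal.conj_mem inferInstance n hn σ, by simp⟩)
  exact ⟨ρ, hρ⟩

/-- Right translation by `t`, an involution of `X` commuting with the action of `G`. -/
theorem exists_involution_commute (ht : ∀ x y, ∃ σ, a σ x = y) {x₀ : X} {t : G}
    (hcomm : ∀ h, a h x₀ = x₀ → h * t = t * h) (htt : a (t * t) x₀ = x₀) :
    ∃ τ : Equiv.Perm X, τ * τ = 1 ∧ ∀ σ, τ (a σ x₀) = a (σ * t) x₀ := by
  choose s hs using ht x₀
  -- `s x` is a chosen element carrying `x₀` to `x`; the choice is immaterial because `t` commutes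
  -- with the stabiliser of `x₀`.
  let f : X → X := fun x => a (s x * t) x₀
  have hf : ∀ σ, f (a σ x₀) = a (σ * t) x₀ := by
    intro σ
    have h1 : a (σ⁻¹ * s (a σ x₀)) x₀ = x₀ := by
      rw [map_mul, Equiv.Perm.mul_apply, hs, ← Equiv.Perm.mul_apply, ← map_mul, inv_mul_cancel,
        map_one, Equiv.Perm.one_apply]
    have h2 : s (a σ x₀) * t = σ * t * (σ⁻¹ * s (a σ x₀)) := by
      rw [mul_assoc σ, ← hcomm _ h1]
      group
    change a (s (a σ x₀) * t) x₀ = _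
    rw [h2, map_mul, Equiv.Perm.mul_apply, h1]
  have hinv : Function.Involutive f := by
    intro x
    obtain ⟨σ, rfl⟩ := ht x₀ x
    rw [hf σ, hf (σ * t), mul_assoc, map_mul, Equiv.Perm.mul_apply, htt]
  exact ⟨hinv.toPerm, Equiv.ext hinv, hf⟩

/-- `τ` and `a g` commute and have coprime orders `2` and `p`, so their product generates a cyclic
group of order `2 * p`. Its even powers act freely by `hfree`, its odd powers have no fixed point by
`hτfree`. -/
theorem exists_isRegNormalized_of_involution [Finite X] [IsCyclic C] [Nonempty X] {p : ℕ}
    (hp : p.Prime) (hp2 : p ≠ 2)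
    (hC : Nat.card C = 2 * p) (hX : Nat.card X = 2 * p) (ha : Function.Injective a) {g : G}
    (hg : orderOf g = p) (hconj : ∀ σ, σ * g * σ⁻¹ ∈ Subgroup.zpowers g)
    (hfree : ∀ n ∈ Subgroup.zpowers g, ∀ x, a n x = x → n = 1) {τ : Equiv.Perm X}
    (hτ : τ * τ = 1) (hcomm : ∀ σ, τ * a σ = a σ * τ)
    (hτfree : ∀ n ∈ Subgroup.zpowers g, ∀ x, τ x ≠ a n x) :
    ∃ ρ : C →* Equiv.Perm X, IsRegNormalized a ρ ∧ τ ∈ ρ.range ∧ a g ∈ ρ.range := by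
  have hτ1 : τ ≠ 1 := by
    rintro rfl
    exact hτfree 1 (Subgroup.one_mem _) (Classical.arbitrary X) (by rw [map_one])
  have hτo : orderOf τ = 2 := orderOf_eq_prime (by rw [pow_two, hτ]) hτ1
  have hgo : orderOf (a g) = p := by rw [orderOf_injective a ha, hg]
  have hcg : Commute τ (a g) := hcomm g
  have hpo := hp.odd_of_ne_two hp2
  set π := τ * a g with hπ
  have hπo : orderOf π = 2 * p := by
    rw [hπ, hcg.orderOf_mul_eq_mul_orderOf_of_coprime, hτo, hgo]
    rw [hτo, hgo]
    exact (Nat.coprime_primes Nat.prime_two hp).2 hp2.symm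
  have hτmem : τ ∈ Subgroup.zpowers π := by
    refine ⟨p, ?_⟩
    obtain ⟨l, hl⟩ := hpo
    have h1 : (a g) ^ p = 1 := by rw [← hgo, pow_orderOf_eq_one]
    have h2 : τ ^ p = τ := by rw [hl, pow_succ, pow_mul, pow_two, hτ, one_pow, one_mul]
    simp only [zpow_natCast]
    rw [hπ, hcg.mul_pow, h1, h2, mul_one]
  have hgmem : a g ∈ Subgroup.zpowers π := by
    have : a g = τ⁻¹ * π := by rw [hπ, inv_mul_cancel_left]
    rw [this]
    exact Subgroup.mul_mem _ (Subgroup.inv_mem _ hτmem) (Subgroup.mem_zpowers π)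
  have hcard : Nat.card (Subgroup.zpowers π) = 2 * p := by rw [Nat.card_zpowers, hπo]
  obtain ⟨ρ, hρ, hr⟩ := exists_isRegNormalized_of_subgroup (a := a) (C := C)
    (P := Subgroup.zpowers π) (hcard.trans hC.symm) (hcard.trans hX.symm) (by
      rintro _ ⟨n, rfl⟩ x hx
      simp only [hπ, hcg.mul_zpow] at hx ⊢
      rcases Int.even_or_odd' n with ⟨l, hl | hl⟩
      · have h1 : τ ^ n = 1 := by
          rw [hl, zpow_mul]
          norm_cast
          rw [pow_two, hτ, one_zpow]
        rw [h1, one_mul, ← map_zpow] at hx ⊢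
        rw [hfree _ (Subgroup.zpow_mem_zpowers g n) x hx, map_one]
      · exfalso
        have h1 : τ ^ n = τ := by
          rw [hl, zpow_add, zpow_mul]
          norm_cast
          rw [pow_two, hτ, one_zpow, one_mul, pow_one]
        rw [h1, ← map_zpow, hcomm, Equiv.Perm.mul_apply] at hx
        refine hτfree (g ^ (-n)) (Subgroup.zpow_mem_zpowers g _) x ?_
        conv_rhs => rw [← hx]
        rw [← Equiv.Perm.mul_apply, ← map_mul, ← zpow_add, neg_add_cancel, zpow_zero, map_one,
          Equiv.Perm.one_apply]) (by
      rintro σ _ ⟨n, rfl⟩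
      simp only
      rw [← conj_zpow]
      refine Subgroup.zpow_mem _ ?_ n
      have h1 : a σ * π * (a σ)⁻¹ = τ * a (σ * g * σ⁻¹) := by
        rw [hπ, ← mul_assoc, ← hcomm, map_mul, map_mul, map_inv]
        simp only [mul_assoc]
      obtain ⟨k, hk⟩ := hconj σ
      rw [h1, ← hk]
      simp only [map_zpow]
      exact Subgroup.mul_mem _ hτmem (Subgroup.zpow_mem _ hgmem k))
  exact ⟨ρ, hρ, hr ▸ hτmem, hr ▸ hgmem⟩

/-- The involution is right translation by `t`. If it moved `a σ x₀` within its orbit under `g`,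
then `t * h` would lie in the normal subgroup generated by `g` for some `h` fixing `x₀`, which `htg`
forbids. -/
theorem exists_isRegNormalized_of_commute_stabilizer [Finite X] [IsCyclic C] {p : ℕ}
    (hp : p.Prime) (hp2 : p ≠ 2)
    (hC : Nat.card C = 2 * p) (hX : Nat.card X = 2 * p) (ha : Function.Injective a)
    (ht : ∀ x y, ∃ σ, a σ x = y) {g : G} (hg : orderOf g = p) [(Subgroup.zpowers g).Normal]
    {x₀ : X} {t : G} (hcomm : ∀ h, a h x₀ = x₀ → h * t = t * h) (htt : a (t * t) x₀ = x₀)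
    (htg : ∀ h, a h x₀ = x₀ → t * h ∉ Subgroup.zpowers g) :
    ∃ ρ : C →* Equiv.Perm X, IsRegNormalized a ρ ∧ a g ∈ ρ.range ∧
      ∃ τ ∈ ρ.range, τ * τ = 1 ∧ τ x₀ = a t x₀ := by
  have : Nonempty X := ⟨x₀⟩
  obtain ⟨τ, hτ, hτa⟩ := exists_involution_commute ht hcomm htt
  obtain ⟨ρ, hρ, hτρ, hgρ⟩ := exists_isRegNormalized_of_involution (C := C) hp hp2 hC hX ha hg
    (fun σ => Subgroup.Normal.conj_mem inferInstance g (Subgroup.mem_zpowers g) σ)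
    (fun n hn x hx => eq_one_of_mem_normal_of_apply_eq ha ht hn hx) hτ (fun σ => by
      ext x
      obtain ⟨σ', rfl⟩ := ht x₀ x
      have hmul : ∀ α β, a α (a β x₀) = a (α * β) x₀ := fun α β => by rw [map_mul]; rfl
      change τ (a σ (a σ' x₀)) = a σ (τ (a σ' x₀))
      rw [hmul, hτa, hτa, hmul, mul_assoc]) (fun n hn x hx => by
      obtain ⟨σ, rfl⟩ := ht x₀ x
      rw [hτa, ← Equiv.Perm.mul_apply, ← map_mul] at hx
      refine htg ((σ * t)⁻¹ * (n * σ)) ?_ ?_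
      · rw [map_mul, Equiv.Perm.mul_apply, ← hx, ← Equiv.Perm.mul_apply, ← map_mul, inv_mul_cancel,
          map_one, Equiv.Perm.one_apply]
      · have := Subgroup.Normal.conj_mem (inferInstance : (Subgroup.zpowers g).Normal) n hn σ⁻¹
        convert this using 1
        group)
  refine ⟨ρ, hρ, hgρ, τ, hτρ, hτ, ?_⟩
  simpa using hτa 1

end Construction

/-! ### Existence for the two families of semidirect products. -/

section ExistsOfSemidirect

variable {G X C : Type*} [Group G] [CommGroup C] {a : G →* Equiv.Perm X}

/-- The kernel of the projection to `C_m` is normal, cyclic and of order `|X|`, hence already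
regular. -/
theorem IsCyclicSemidirect.exists_isRegNormalized_of_natCard_eq [Finite X] [IsCyclic C] {n m : ℕ}
    (ha : Function.Injective a) (ht : ∀ x y, ∃ σ, a σ x = y) (hC : Nat.card C = n)
    (hX : Nat.card X = n) (h : IsCyclicSemidirect G n m) :
    ∃ ρ : C →* Equiv.Perm X, IsRegNormalized a ρ := by
  obtain ⟨φ, -, ⟨e⟩⟩ := h
  let q : G →* Cyc m := SemidirectProduct.rightHom.comp e.toMonoidHom
  let f : Cyc n →* q.ker := (e.symm.toMonoidHom.comp SemidirectProduct.inl).codRestrict q.ker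
    fun c => by simp [q, MonoidHom.mem_ker]
  have hf : Function.Bijective f := by
    constructor
    · intro c d hcd
      have : e.symm (SemidirectProduct.inl c) = e.symm (SemidirectProduct.inl d) :=
        congrArg Subtype.val hcd
      exact SemidirectProduct.inl_injective (e.symm.injective this)
    · rintro ⟨σ, hσ⟩
      have : (e σ).right = 1 := hσ
      refine ⟨(e σ).left, Subtype.ext ?_⟩
      change e.symm (SemidirectProduct.inl (e σ).left) = σ
      rw [MulEquiv.symm_apply_eq]
      ext <;> simp [this]
  have : IsCyclic q.ker := isCyclic_of_surjective f hf.2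
  have hcard : Nat.card q.ker = n := by rw [← Nat.card_congr (Equiv.ofBijective f hf), natCard_cyc]
  exact exists_isRegNormalized_of_normal ha ht (N := q.ker) (hcard.trans hC.symm)
    (hcard.trans hX.symm)

/-- In an extension of a group by a group of prime order, a square in the quotient by an element
which does not invert the kernel lifts to a square. -/
theorem exists_mul_self_eq_of_isCyclic {N : Subgroup G} [N.Normal] [IsCyclic N] {p : ℕ}
    (hp : p.Prime) (hN : Nat.card N = p) {r h : G} (hr : h * (r * r)⁻¹ ∈ N)
    (hinv : ¬ ∀ n ∈ N, r * n * r⁻¹ = n⁻¹) : ∃ y ∈ N, (y * r) * (y * r) = h := by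
  obtain ⟨k, hk⟩ := MonoidHom.map_cyclic (MulAut.conjNormal (H := N) r).toMonoidHom
  have hk' : ∀ n ∈ N, r * n * r⁻¹ = n ^ k := fun n hn => by
    simpa using congrArg Subtype.val (hk ⟨n, hn⟩)
  have hpow : ∀ l : ℤ, (p : ℤ) ∣ l → ∀ n ∈ N, n ^ l = 1 := fun l hl n hn => by
    rw [← orderOf_dvd_iff_zpow_eq_one]
    refine (Int.natCast_dvd_natCast.2 ?_).trans hl
    exact hN ▸ Subgroup.orderOf_dvd_natCard N hn
  -- Conjugation by `r` is the `k`-th power map on `N`, so `(y * r)² = y ^ (k + 1) * r²`; solving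
  -- for `y` requires `k + 1` to be invertible modulo `p`.
  have hcop : IsCoprime (k + 1) (p : ℤ) := by
    rw [isCoprime_comm, Prime.coprime_iff_not_dvd (Nat.prime_iff_prime_int.1 hp)]
    refine fun hd => hinv fun n hn => ?_
    rw [hk' n hn, eq_inv_iff_mul_eq_one, ← zpow_add_one]
    exact hpow _ hd n hn
  obtain ⟨u, v, huv⟩ := hcop
  refine ⟨_, N.zpow_mem hr u, ?_⟩
  set n := h * (r * r)⁻¹ with hn
  have h1 : n ^ u * r * (n ^ u * r) = n ^ u * (r * n ^ u * r⁻¹) * (r * r) := by group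
  have h2 : n ^ (u * (k + 1)) = n := by
    have : n ^ (v * (p : ℤ)) = 1 := hpow _ (dvd_mul_left _ _) n hr
    rw [← mul_one (n ^ (u * (k + 1))), ← this, ← zpow_add, huv, zpow_one]
  rw [h1, hk' _ (N.zpow_mem hr u), ← zpow_mul, ← zpow_add, show u + u * k = u * (k + 1) by ring, h2,
    hn, inv_mul_cancel_right]

/-- The stabiliser `H` of a point meets `C_p` trivially and maps onto the subgroup of index two in
`C_m`. So `H` is generated by the element `h` above `s * s`, with `s` a generator of `C_m`. It
suffices to find `t` above `s` with `t * t = h`: it commutes with `H`, and `s` lies outside the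
image of `H`. If `s` does not invert `C_p`, a lift of `s` can be corrected by an element of `C_p`;
if it does, faithfulness gives `s * s = 1`, so `h = 1` and the standard lift works. -/
theorem IsCyclicSemidirect.exists_isRegNormalized_of_even [Finite G] [Finite X] [IsCyclic C]
    {p m : ℕ}
    (hp : p.Prime) (hp2 : p ≠ 2) (hC : Nat.card C = 2 * p) (hX : Nat.card X = 2 * p)
    (ha : Function.Injective a) (ht : ∀ x y, ∃ σ, a σ x = y)
    (h : IsCyclicSemidirect G p m) :
    ∃ ρ : C →* Equiv.Perm X, IsRegNormalized a ρ := by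
  have hG := h.natCard_eq
  obtain ⟨φ, hφ, ⟨e⟩⟩ := h
  have : Nonempty X := (Nat.card_ne_zero.1 (by rw [hX]; exact mul_ne_zero two_ne_zero hp.ne_zero)).1
  let x₀ := Classical.arbitrary X
  let q : G →* Cyc m := SemidirectProduct.rightHom.comp e.toMonoidHom
  have hqs : Function.Surjective q := SemidirectProduct.rightHom_surjective.comp e.surjective
  have hN : Nat.card q.ker = p := by
    have hm : Nat.card q.range = m := by
      rw [MonoidHom.range_eq_top.2 hqs, Subgroup.card_top, natCard_cyc]
    have h1 := Subgroup.card_mul_index q.ker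
    rw [Subgroup.index_ker, hm, hG] at h1
    refine Nat.eq_of_mul_eq_mul_right (Nat.pos_of_ne_zero ?_) h1
    rintro rfl
    exact Nat.card_pos.ne' (hG.trans (mul_zero p))
  have := Fact.mk hp
  have : IsCyclic q.ker := isCyclic_of_prime_card hN
  let H : Subgroup G := (MulAction.stabilizer (Equiv.Perm X) x₀).comap a
  have hH : H.index = 2 * p := (index_comap_stabilizer ht x₀).trans hX
  have hdisj : ∀ σ ∈ H, σ ∈ q.ker → σ = 1 := fun σ hσ hσq =>
    eq_one_of_mem_normal_of_apply_eq ha ht hσq hσ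
  have hinj : Function.Injective (q.comp H.subtype) := by
    rw [injective_iff_map_eq_one]
    exact fun σ hσ => Subtype.ext (hdisj σ σ.2 hσ)
  have hindex : (H.map q).index = 2 := by
    have h1 : Nat.card (H.map q) = Nat.card H := by
      rw [← H.range_subtype, MonoidHom.map_range, H.range_subtype]
      exact Nat.card_congr (MonoidHom.ofInjective hinj).symm.toEquiv
    have h2 := Subgroup.card_mul_index (H.map q)
    have h3 := Subgroup.card_mul_index H
    rw [h1, natCard_cyc] at h2
    rw [hH, hG, ← h2] at h3
    have h4 : Nat.card H * p * (H.map q).index = Nat.card H * p * 2 := by linarith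
    exact Nat.eq_of_mul_eq_mul_left (Nat.mul_pos Nat.card_pos hp.pos) h4
  obtain ⟨s, hs⟩ := IsCyclic.exists_generator (α := Cyc m)
  have hsH : s ∉ H.map q := fun hsm => by
    have : H.map q = ⊤ := (Subgroup.eq_top_iff' _).2 fun z =>
      (Subgroup.zpowers_le.2 hsm) (hs z)
    rw [this, Subgroup.index_top] at hindex
    exact absurd hindex (by norm_num)
  have hssH : s * s ∈ H.map q := Subgroup.mul_self_mem_of_index_two hindex s
  obtain ⟨h, hhH, hh⟩ := hssH
  have hgen : ∀ h' ∈ H, h' ∈ Subgroup.zpowers h := by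
    intro h' hh'
    obtain ⟨j, hj⟩ := hs (q h')
    simp only at hj
    obtain ⟨l, hl | hl⟩ := Int.even_or_odd' j
    · refine ⟨l, ?_⟩
      have := @hinj ⟨h ^ l, H.zpow_mem hhH l⟩ ⟨h', hh'⟩ (by
        change q (h ^ l) = q h'
        rw [map_zpow, hh, ← hj, hl, ← zpow_two, zpow_mul])
      exact congrArg Subtype.val this
    · refine absurd ?_ hsH
      have h1 : s = q h' * (q (h ^ l))⁻¹ := by
        rw [← hj, hl, map_zpow, hh, zpow_add, zpow_mul, ← zpow_two, zpow_one, mul_comm,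
          inv_mul_cancel_left]
      rw [h1]
      exact Subgroup.mul_mem _ (Subgroup.mem_map_of_mem q hh')
        (Subgroup.inv_mem _ (Subgroup.mem_map_of_mem q (H.zpow_mem hhH l)))
  obtain ⟨t, hts, hth⟩ : ∃ t, q t = s ∧ t * t = h := by
    let r := e.symm (SemidirectProduct.inr s)
    have hr : q r = s := by simp [q, r]
    by_cases hinv : ∀ n ∈ q.ker, r * n * r⁻¹ = n⁻¹
    · have hss : s * s = 1 := by
        apply hφ
        ext c : 1
        have hc : e.symm (SemidirectProduct.inl c) ∈ q.ker := by simp [q, MonoidHom.mem_ker]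
        have h1 : SemidirectProduct.inr (φ := φ) s * .inl c * .inr s⁻¹ = .inl c⁻¹ := by
          have := congrArg e (hinv _ hc)
          simpa [r] using this
        rw [← SemidirectProduct.inl_aut, SemidirectProduct.inl_inj] at h1
        rw [map_mul, MulAut.mul_apply, h1, map_inv, h1, inv_inv, map_one, MulAut.one_apply]
      refine ⟨r, hr, ?_⟩
      rw [hdisj h hhH (by rw [MonoidHom.mem_ker, hh, hss]), ← map_mul, ← map_mul, hss, map_one,
        map_one]
    · obtain ⟨y, hy, hyr⟩ := exists_mul_self_eq_of_isCyclic (r := r) (h := h) hp hN (by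
        rw [MonoidHom.mem_ker, map_mul, map_inv, map_mul, hr, hh, mul_inv_cancel]) hinv
      exact ⟨y * r, by rw [map_mul, hr, MonoidHom.mem_ker.1 hy, one_mul], hyr⟩
  obtain ⟨g, hg⟩ := IsCyclic.exists_generator (α := q.ker)
  have hgN : Subgroup.zpowers (g : G) = q.ker := by
    apply le_antisymm (Subgroup.zpowers_le.2 g.2)
    intro n hn
    obtain ⟨k, hk⟩ := hg ⟨n, hn⟩
    exact ⟨k, congrArg Subtype.val hk⟩
  have : (Subgroup.zpowers (g : G)).Normal := by
    rw [hgN]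
    infer_instance
  obtain ⟨ρ, hρ, -⟩ := exists_isRegNormalized_of_commute_stabilizer (C := C) (x₀ := x₀) (t := t)
    hp hp2 hC hX ha ht (g := (g : G)) (by rw [← Nat.card_zpowers, hgN, hN]) (by
      intro h' hh'
      obtain ⟨l, rfl⟩ := hgen h' hh'
      simp only [← hth]
      exact (Commute.zpow_left (Commute.mul_left rfl rfl) l).eq) (by rw [hth]; exact hhH) (by
      intro h' hh' hmem
      rw [hgN, MonoidHom.mem_ker, map_mul, hts, mul_eq_one_iff_eq_inv] at hmem
      exact hsH (hmem ▸ Subgroup.inv_mem _ (Subgroup.mem_map_of_mem q hh')))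
  exact ⟨ρ, hρ⟩

end ExistsOfSemidirect

/-! ### Counting normalised regular cyclic groups -/

theorem IsCyclic.mem_zpowers_of_pow_eq_one {C : Type*} [CommGroup C] [Finite C] [IsCyclic C]
    {n : ℕ} {c d : C} (hd : orderOf d = n) (hc : c ^ n = 1) : c ∈ Subgroup.zpowers d := by
  have h1 : Subgroup.zpowers d = (powMonoidHom n : C →* C).ker := by
    apply Subgroup.eq_of_le_of_card_ge
    · rw [Subgroup.zpowers_le, MonoidHom.mem_ker, powMonoidHom_apply, ← hd, pow_orderOf_eq_one]
    · rw [IsCyclic.card_powMonoidHom_ker, Nat.card_zpowers, hd]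
      exact Nat.gcd_le_right (Nat.card C) (hd ▸ orderOf_pos d)
  rw [h1]
  exact hc

namespace IsRegNormalized

variable {G X C : Type*} [Group G] [CommGroup C] [Finite C] [IsCyclic C] {a : G →* Equiv.Perm X}
  {ρ ρ' : C →* Equiv.Perm X} [Nonempty X]

/-- Conjugation by `σ` induces an automorphism of `C`, and automorphisms of `C` fix the elements of
square `1`. -/
theorem commute_of_sq_eq_one (h : IsRegNormalized a ρ) (hC : Even (Nat.card C)) {c : C}
    (hc : c ^ 2 = 1) (σ : G) (x : X) : ρ c (a σ x) = a σ (ρ c x) := by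
  obtain ⟨θ, hθ⟩ := h.exists_conj
  rw [← IsRegNormalized.apply_comm hθ, (θ σ).apply_eq_self_of_sq_eq_one hC hc]

/-- Both permutations commute with a transitive group, so agreement at one point propagates to all.
-/
theorem eq_of_sq_eq_one (h : IsRegNormalized a ρ) (h' : IsRegNormalized a ρ')
    (ht : ∀ x y, ∃ σ, a σ x = y) (hC : Even (Nat.card C)) {c d : C} (hc : c ^ 2 = 1)
    (hd : d ^ 2 = 1) {x : X} (hx : ρ' c x = ρ d x) : ρ' c = ρ d := by
  ext y
  obtain ⟨σ, rfl⟩ := ht x y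
  rw [h'.commute_of_sq_eq_one hC hc, h.commute_of_sq_eq_one hC hd, hx]

variable [Finite G] {p : ℕ}

/-- The subgroup of order `p` in the image of `ρ'` is generated by an element of `G`. That element
also centralises the image of `ρ`, because `Aut C` has order `p - 1`, and so belongs to it. -/
theorem mem_range_of_pow_prime_eq_one (h : IsRegNormalized a ρ) (h' : IsRegNormalized a ρ')
    (ha : Function.Injective a) (ht : ∀ x y, ∃ σ, a σ x = y) (hp : p.Prime) (hp2 : p ≠ 2)
    (hC : Nat.card C = 2 * p) {c : C} (hc : c ^ p = 1) : ρ' c ∈ ρ.range := by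
  obtain ⟨θ, hθ⟩ := h.exists_conj
  obtain ⟨θ', hθ'⟩ := h'.exists_conj
  have h1 : p ∣ Nat.card θ'.ker := by
    rcases h'.natCard_ker ha ht hθ' hp hp2 hC with h1 | h1
    · exact h1 ▸ dvd_rfl
    · exact h1 ▸ dvd_mul_left p 2
  have := Fact.mk hp
  obtain ⟨g, hg⟩ := exists_prime_orderOf_dvd_card' p h1
  rw [← Subgroup.orderOf_coe] at hg
  obtain ⟨d, hd⟩ := h'.exists_eq_of_mem_ker hθ' g.2
  have hdo : orderOf d = p := by
    rw [← orderOf_injective ρ' h'.injective, ← hd, orderOf_injective a ha, hg]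
  have hgθ : (g : G) ∈ θ.ker := by
    have h2 : orderOf (θ g) ∣ p := hg ▸ orderOf_map_dvd θ (g : G)
    have h3 : orderOf (θ g) ∣ p - 1 := by
      rw [← MulAut.natCard_of_isCyclic hp hp2 hC]
      exact orderOf_dvd_natCard _
    have hcop : Nat.Coprime p (p - 1) := (Nat.coprime_self_sub_right hp.one_le).2 (by simp)
    rw [MonoidHom.mem_ker, ← orderOf_eq_one_iff]
    exact Nat.eq_one_of_dvd_coprimes hcop h2 h3
  obtain ⟨d', hd'⟩ := h.exists_eq_of_mem_ker hθ hgθ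
  obtain ⟨k, rfl⟩ := IsCyclic.mem_zpowers_of_pow_eq_one hdo hc
  exact ⟨d' ^ k, by rw [map_zpow, map_zpow, ← hd', ← hd]⟩

theorem range_eq (h : IsRegNormalized a ρ) (h' : IsRegNormalized a ρ')
    (ha : Function.Injective a) (ht : ∀ x y, ∃ σ, a σ x = y) (hp : p.Prime) (hp2 : p ≠ 2)
    (hC : Nat.card C = 2 * p) (h2 : ∀ c, c ^ 2 = 1 → ρ' c ∈ ρ.range) : ρ'.range = ρ.range := by
  have : Finite ρ.range := Finite.of_surjective _ ρ.rangeRestrict_surjective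
  apply Subgroup.eq_of_le_of_card_ge
  · rintro _ ⟨c, rfl⟩
    obtain ⟨l, hl⟩ := hp.odd_of_ne_two hp2
    have hc : c ^ (2 * p) = 1 := by rw [← hC, pow_card_eq_one']
    -- With `p = 2 * l + 1`, this splits `c` into a factor of square `1` and a factor whose `p`-th
    -- power is `1`.
    have h1 : c = c ^ p * (c ^ (2 * l))⁻¹ := by rw [hl, pow_succ', mul_inv_cancel_right]
    rw [h1, map_mul, map_inv]
    refine Subgroup.mul_mem _ (h2 _ ?_) (Subgroup.inv_mem _ ?_)
    · rw [← pow_mul, mul_comm, hc]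
    · refine h.mem_range_of_pow_prime_eq_one h' ha ht hp hp2 hC ?_
      rw [← pow_mul, show 2 * l * p = 2 * p * l by ring, pow_mul, hc, one_pow]
  · rw [← Nat.card_congr (MonoidHom.ofInjective h.injective).toEquiv,
      ← Nat.card_congr (MonoidHom.ofInjective h'.injective).toEquiv]

/-- For `c` of square `1`, `ρ' c` commutes with `g`, so `g` fixes `ρ' c x = ρ d x` and `θ g` fixes
`d`. Were `d ^ 2 ≠ 1`, `g` would centralise `C`, hence act as an element of the regular group with a
fixed point, and be trivial. So `ρ' c` and `ρ d` are determined by their common value at `x`. -/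
theorem range_eq_of_exists_fixed (h : IsRegNormalized a ρ) (h' : IsRegNormalized a ρ')
    (ha : Function.Injective a) (ht : ∀ x y, ∃ σ, a σ x = y) (hp : p.Prime) (hp2 : p ≠ 2)
    (hC : Nat.card C = 2 * p) {g : G} (hg : g ≠ 1) {x : X} (hx : a g x = x) :
    ρ'.range = ρ.range := by
  refine h.range_eq h' ha ht hp hp2 hC fun c hc => ?_
  have hCe : Even (Nat.card C) := by simp [hC]
  obtain ⟨θ, hθ⟩ := h.exists_conj
  obtain ⟨d, hd⟩ := (h.bijective x).2 (ρ' c x)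
  simp only at hd
  have h1 : θ g d = d := by
    apply (h.bijective x).1
    simp only
    conv_lhs => rw [← hx]
    rw [IsRegNormalized.apply_comm hθ, hd, ← h'.commute_of_sq_eq_one hCe hc, hx]
  have h2 : d ^ 2 = 1 := by
    by_contra h2
    have h3 : g ∈ θ.ker := (θ g).eq_one_of_apply_eq_self hp hp2 hC h2 h1
    obtain ⟨e, he⟩ := h.exists_eq_of_mem_ker hθ h3
    have h4 : e = 1 := (h.bijective x).1 (by
      simp only [map_one, Equiv.Perm.one_apply, ← he, hx])
    exact hg (ha (by rw [he, h4, map_one, map_one]))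
  exact ⟨d, (h.eq_of_sq_eq_one h' ht hCe hc h2 hd.symm).symm⟩

/-- A kernel of order `p` would make `G` a faithful `C_p ⋊ C_2`, which is dihedral. So the kernel is
all of `G`, which then lies in the image of `ρ` and has the same order. -/
theorem range_eq_range_of_regular (h : IsRegNormalized a ρ)
    (ha : Function.Injective a) (ht : ∀ x y, ∃ σ, a σ x = y) (hp : p.Prime) (hp2 : p ≠ 2)
    (hC : Nat.card C = 2 * p) (hG : Nat.card G = 2 * p)
    (hD : ¬ Nonempty (G ≃* DihedralGroup p)) : ρ.range = a.range := by
  obtain ⟨θ, hθ⟩ := h.exists_conj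
  have hk : Nat.card θ.ker = 2 * p := by
    refine (h.natCard_ker ha ht hθ hp hp2 hC).resolve_left fun hk => hD ?_
    have hind : θ.ker.index = 2 := by
      have := Subgroup.card_mul_index θ.ker
      rw [hk, hG, mul_comm 2] at this
      exact Nat.eq_of_mul_eq_mul_left hp.pos this
    obtain ⟨Q, hQ⟩ := Subgroup.exists_right_complement'_of_coprime (N := θ.ker) (by
      rw [hk, hind, Nat.coprime_primes hp Nat.prime_two]
      exact hp2)
    have hQ2 : Nat.card Q = 2 := by
      have := hQ.card_mul_card
      rw [hk, hG, mul_comm 2] at this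
      exact Nat.eq_of_mul_eq_mul_left hp.pos this
    have := (h.isCyclicSemidirect_of_isComplement' ha ht hθ hp hp2 hC hQ).2
    rw [hk, hQ2] at this
    exact this.nonempty_mulEquiv_dihedralGroup hp
  have htop : θ.ker = ⊤ := Subgroup.eq_top_of_card_eq _ (hk.trans hG.symm)
  have : Finite ρ.range := Finite.of_surjective _ ρ.rangeRestrict_surjective
  refine (Subgroup.eq_of_le_of_card_ge ?_ ?_).symm
  · rintro _ ⟨σ, rfl⟩
    obtain ⟨c, hc⟩ := h.exists_eq_of_mem_ker hθ (σ := σ) (htop ▸ Subgroup.mem_top σ)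
    exact ⟨c, hc.symm⟩
  · rw [← Nat.card_congr (MonoidHom.ofInjective h.injective).toEquiv,
      ← Nat.card_congr (MonoidHom.ofInjective ha).toEquiv, hC, hG]

theorem ncard_regNormalizedSubgroups (h : IsRegNormalized a ρ)
    (ha : Function.Injective a) (ht : ∀ x y, ∃ σ, a σ x = y) (hp : p.Prime) (hp2 : p ≠ 2)
    (hC : Nat.card C = 2 * p) (hD : ¬ Nonempty (G ≃* DihedralGroup p)) :
    (regNormalizedSubgroups a C).ncard = 1 := by
  rw [Set.ncard_eq_one]
  refine ⟨ρ.range, Set.eq_singleton_iff_unique_mem.2 ⟨⟨ρ, h, rfl⟩, ?_⟩⟩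
  rintro _ ⟨ρ', h', rfl⟩
  by_cases hfix : ∃ g : G, g ≠ 1 ∧ ∃ x, a g x = x
  · obtain ⟨g, hg, x, hx⟩ := hfix
    exact h.range_eq_of_exists_fixed h' ha ht hp hp2 hC hg hx
  · have hG : Nat.card G = 2 * p := by
      rw [← hC, h.natCard_eq]
      let x := Classical.arbitrary X
      refine Nat.card_congr (Equiv.ofBijective (fun σ => a σ x) ⟨fun σ τ hστ => ?_, ht x⟩)
      by_contra hne
      refine hfix ⟨τ⁻¹ * σ, fun h1 => hne (inv_mul_eq_one.1 h1).symm, x, ?_⟩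
      have hστ' : a σ x = a τ x := hστ
      rw [map_mul, Equiv.Perm.mul_apply, hστ', ← Equiv.Perm.mul_apply, ← map_mul, inv_mul_cancel,
        map_one, Equiv.Perm.one_apply]
    rw [h.range_eq_range_of_regular ha ht hp hp2 hC hG hD,
      h'.range_eq_range_of_regular ha ht hp hp2 hC hG hD]

end IsRegNormalized

/-- `G` acts regularly, so the involution of a normalised regular group sends the base point `x` to
`a s x` for a unique `s`, and commuting with `G` forces `s` to be an involution. As `p` is odd, `s`
is one of the `p` reflections; each of them occurs, and it determines the group. -/
theorem ncard_regNormalizedSubgroups_of_dihedralGroup {G X C : Type*} [Group G] [CommGroup C]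
    [Finite C] [IsCyclic C] [Finite X] {a : G →* Equiv.Perm X} {p : ℕ} (hp : p.Prime) (hp2 : p ≠ 2)
    (ha : Function.Injective a) (ht : ∀ x y, ∃ σ, a σ x = y) (hC : Nat.card C = 2 * p)
    (hX : Nat.card X = 2 * p) (e : G ≃* DihedralGroup p) :
    (regNormalizedSubgroups a C).ncard = p := by
  have : NeZero p := ⟨hp.ne_zero⟩
  have : Finite G := Finite.of_equiv _ e.symm.toEquiv
  have : Nonempty X := (Nat.card_ne_zero.1 (by rw [hX]; exact mul_ne_zero two_ne_zero hp.ne_zero)).1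
  have hCe : Even (Nat.card C) := by simp [hC]
  let x := Classical.arbitrary X
  have hfree : Function.Injective fun σ => a σ x := by
    have hs : Function.Surjective fun σ => a σ x := ht x
    refine ((Nat.bijective_iff_surjective_and_card _).2 ⟨hs, ?_⟩).1
    rw [hX, Nat.card_congr e.toEquiv, DihedralGroup.nat_card]
  have hfree1 : ∀ σ, a σ x = x → σ = 1 := fun σ hσ => hfree (by simpa using hσ)
  let t : ZMod p → G := fun i => e.symm (.sr i)
  have ht1 : ∀ i, t i ≠ 1 := fun i hi => by
    have : DihedralGroup.sr i = 1 := by simpa [t] using hi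
    rw [DihedralGroup.one_def] at this
    cases this
  have htt : ∀ i, t i * t i = 1 := fun i => by
    rw [← map_mul, DihedralGroup.sr_mul_self, map_one]
  let g : G := e.symm (.r 1)
  have hg : orderOf g = p := by
    rw [MulEquiv.orderOf_eq, DihedralGroup.orderOf_r_one]
  have hmem : ∀ σ, σ ∈ Subgroup.zpowers g ↔ ∃ i, e σ = .r i := by
    intro σ
    constructor
    · rintro ⟨k, rfl⟩
      exact ⟨k, by simp [g]⟩
    · rintro ⟨i, hi⟩
      obtain ⟨k, rfl⟩ := ZMod.intCast_surjective i
      exact ⟨k, e.injective (by simp [g, hi])⟩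
  have hnorm : (Subgroup.zpowers g).Normal := ⟨fun n hn σ => by
    rw [hmem] at hn ⊢
    obtain ⟨i, hi⟩ := hn
    rw [map_mul, map_mul, map_inv, hi]
    rcases e σ with j | j
    · exact ⟨i, by rw [DihedralGroup.inv_r, DihedralGroup.r_mul_r, DihedralGroup.r_mul_r]; congr; ring⟩
    · exact ⟨_, by rw [DihedralGroup.inv_sr, DihedralGroup.sr_mul_r, DihedralGroup.sr_mul_sr]⟩⟩
  have hex := fun i => exists_isRegNormalized_of_commute_stabilizer (C := C) (x₀ := x) (t := t i)
    hp hp2 hC hX ha ht hg (fun h hh => by rw [hfree1 h hh, one_mul, mul_one])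
    (by rw [htt, map_one, Equiv.Perm.one_apply]) (fun h hh => by
      rw [hfree1 h hh, mul_one, hmem]
      rintro ⟨j, hj⟩
      simp [t] at hj)
  choose ρ hρ _ τ hτρ hττ hτx using hex
  have hinj : Function.Injective fun i => (ρ i).range := by
    intro i j hij
    have hij' : (ρ i).range = (ρ j).range := hij
    obtain ⟨c, hc⟩ := hτρ i
    obtain ⟨d, hd⟩ : τ j ∈ (ρ i).range := hij' ▸ hτρ j
    have key : ∀ (k : ZMod p) (c : C), ρ i c = τ k → c ^ 2 = 1 ∧ c ≠ 1 := by
      refine fun k c hc => ⟨(hρ i).injective ?_, ?_⟩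
      · rw [map_pow, hc, pow_two, hττ, map_one]
      · rintro rfl
        refine ht1 k (hfree1 _ ?_)
        rw [← hτx, ← hc, map_one, Equiv.Perm.one_apply]
    have h1 : c = d := IsCyclic.eq_of_sq_eq_one (key i c hc).1 (key i c hc).2 (key j d hd).1
      (key j d hd).2
    have h2 : t i = t j := hfree (by
      change a (t i) x = a (t j) x
      rw [← hτx, ← hτx, ← hc, ← hd, h1])
    simpa [t] using h2
  have hrange : regNormalizedSubgroups a C = Set.range fun i => (ρ i).range := by
    apply Set.Subset.antisymm
    · rintro _ ⟨ρ', h', rfl⟩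
      obtain ⟨c, hc⟩ := exists_prime_orderOf_dvd_card' (G := C) 2 hCe.two_dvd
      have hc2 : c ^ 2 = 1 := hc ▸ pow_orderOf_eq_one c
      have hc1 : c ≠ 1 := by
        rintro rfl
        simp at hc
      obtain ⟨s, hs⟩ := ht x (ρ' c x)
      have hss : s * s = 1 := hfree1 _ (by
        rw [map_mul, Equiv.Perm.mul_apply, hs, ← h'.commute_of_sq_eq_one hCe hc2, hs,
          ← Equiv.Perm.mul_apply, ← map_mul, ← pow_two, hc2, map_one, Equiv.Perm.one_apply])
      have hs1 : s ≠ 1 := by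
        rintro rfl
        refine hc1 ((h'.bijective x).1 ?_)
        simp only [← hs, map_one]
      obtain ⟨i, hi⟩ : ∃ i, s = t i := by
        -- A rotation of square `1` is trivial, because `2` is invertible modulo `p`.
        rcases hes : e s with i | i
        · exfalso
          have h1 : e s * e s = 1 := by rw [← map_mul, hss, map_one]
          rw [hes, DihedralGroup.r_mul_r, DihedralGroup.one_def, DihedralGroup.r.injEq] at h1
          have h2 : (2 : ZMod p) ≠ 0 := by
            have := Fact.mk hp
            exact_mod_cast (ZMod.natCast_eq_zero_iff 2 p).not.2 fun h2 =>
              hp2 ((Nat.prime_dvd_prime_iff_eq hp Nat.prime_two).1 h2)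
          have := Fact.mk hp
          rw [← two_mul, mul_eq_zero_iff_left h2] at h1
          rw [h1] at hes
          exact hs1 (e.injective (by rw [hes, map_one, DihedralGroup.one_def]))
        · exact ⟨i, by simp [t, ← hes]⟩
      refine ⟨i, ((hρ i).range_eq h' ha ht hp hp2 hC fun d hd => ?_).symm⟩
      by_cases hd1 : d = 1
      · rw [hd1, map_one]
        exact Subgroup.one_mem _
      · rw [IsCyclic.eq_of_sq_eq_one hd hd1 hc2 hc1]
        obtain ⟨b, hb⟩ := hτρ i
        have hb2 : b ^ 2 = 1 := (hρ i).injective (by rw [map_pow, hb, pow_two, hττ, map_one])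
        exact ⟨b, ((hρ i).eq_of_sq_eq_one h' ht hCe hc2 hb2 (x := x)
          (by rw [← hs, hb, hτx, hi])).symm⟩
    · rintro _ ⟨i, rfl⟩
      exact ⟨ρ i, hρ i, rfl⟩
  rw [hrange, Set.ncard_range_of_injective hinj, Nat.card_zmod]

/-! ### The classification and the count. -/

theorem theorem5p1 (K : Type u) (L : Type v) (M : Type w) [Field K] [Field L] [Field M]
    [Algebra K L] [Algebra K M] [Algebra.IsSeparable K L] [IsNormalClosure K L M]
    (p : ℕ) (hp : p.Prime) (hp2 : p ≠ 2) (hdeg : Module.finrank K L = 2 * p) :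
    ((∃ S : HopfGaloisStructure K L, S.IsOfType M (Cyc (2 * p))) ↔
      ((∃ m : ℕ, m ∣ p - 1 ∧ IsCyclicSemidirect (M ≃ₐ[K] M) (2 * p) m) ∨
        (∃ m : ℕ, Even m ∧ m ∣ p - 1 ∧ IsCyclicSemidirect (M ≃ₐ[K] M) p m))) ∧
    ((∃ S : HopfGaloisStructure K L, S.IsOfType M (Cyc (2 * p))) →
      (Nonempty ((M ≃ₐ[K] M) ≃* DihedralGroup p) →
        (HopfGaloisStructure.classesOfType K L M (Cyc (2 * p))).ncard = p) ∧
      (¬ Nonempty ((M ≃ₐ[K] M) ≃* DihedralGroup p) →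
        (HopfGaloisStructure.classesOfType K L M (Cyc (2 * p))).ncard = 1)) := by
  have : FiniteDimensional K L := Module.finite_of_finrank_pos (by
    rw [hdeg]
    exact Nat.mul_pos two_pos hp.pos)
  have : FiniteDimensional K M := finiteDimensional_of_isNormalClosure K L M
  have : NeZero (2 * p) := ⟨mul_ne_zero two_ne_zero hp.ne_zero⟩
  have hC : Nat.card (Cyc (2 * p)) = 2 * p := natCard_cyc _
  have hCL : Nat.card (Cyc (2 * p)) = Module.finrank K L := hC.trans hdeg.symm
  have hX : Nat.card (L →ₐ[K] M) = 2 * p := (card_embeddings K L M).trans hdeg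
  have hne := nonempty_embeddings K L M
  have ha := embPerm_injective K L M
  have ht := embPerm_transitive K L M
  rw [exists_isOfType_iff K L M _ hCL, ncard_classesOfType K L M _ hCL]
  refine ⟨⟨?_, ?_⟩, ?_⟩
  · rintro ⟨ρ, hρ⟩
    exact hρ.isCyclicSemidirect ha ht hp hp2 hC
  · rintro (⟨m, -, h⟩ | ⟨m, -, -, h⟩)
    · exact h.exists_isRegNormalized_of_natCard_eq ha ht hC hX
    · exact h.exists_isRegNormalized_of_even hp hp2 hC hX ha ht
  · rintro ⟨ρ, hρ⟩
    exact ⟨fun ⟨e⟩ => ncard_regNormalizedSubgroups_of_dihedralGroup hp hp2 ha ht hC hX e,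
      fun hD => hρ.ncard_regNormalizedSubgroups ha ht hp hp2 hC hD⟩
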